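/- **Setting.** Let $d\ge 1$, and let $f:\mathbb R^d\to\mathbb R$ be twice differentiable, bounded below, with $\|\nabla^2 f(x)-\nabla^2 f(y)\|\le L\|x-y\|$ for all $x,y$ (Euclidean norm for vectors, spectral norm for matrices). Fix $x_0\in\mathbb R^d$ and put $F_0=f(x_0)-\inf f$. For $c>0$ let $$\mu_c(x)=\max\Bigl(\|\nabla f(x)\|^{3/2},\ \frac{-\lambda_{\min}(\nabla^2 f(x))^3}{c^{3/2}}\Bigr).$$ Let $f_\xi$ be a measurable family of twice differentiable functions. **Algorithm.** Let $T\ge 1$, $M>0$ and $\alpha,\beta\in(0,1]$. For $t=0,\dots,T-1$ draw samples $\xi^g_t,\xi^h_t$ (possibly equal or dependent on one another), each independent of the past. Put $g_0=\nabla f_{\xi^g_0}(x_0)$, $H_0=\nabla^2 f_{\xi^h_0}(x_0)$ and, for $t\ge 1$, $$g_t=(1-\alpha)g_{t-1}+\alpha\nabla f_{\xi^g_t}\bigl(x_t+\tfrac{1-\alpha}{\alpha}(x_t-x_{t-1})\bigr),\qquad H_t=(1-\beta)H_{t-1}+\beta\nabla^2 f_{\xi^h_t}(x_t).$$ Let $x_{t+1}$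 be any global minimizer over $y\in\mathbb R^d$ (chosen measurably, without knowledge of future samples) of $$\langle g_t,y-x_t\rangle+\tfrac12\langle H_t(y-x_t),y-x_t\rangle+\tfrac M6\|y-x_t\|^3.$$ The output $x_{\rm out}$ is drawn uniformly at random from $x_1,\dots,x_T$, independently of these iterates. **Noise.** There are constants $\sigma_g,\sigma_h,\delta_h,\sigma_{g,0},\sigma_{h,0}\ge 0$ such that for $1\le t<T$ and all $x\in\mathbb R^d$: * $\mathbb E\nabla f_{\xi^g_t}(x)=\nabla f(x)$ and $\mathbb E\|\nabla f_{\xi^g_t}(x)-\nabla f(x)\|^2\le\sigma_g^2$; * $\mathbb E\nabla^2 f_{\xi^h_t}(x)=\nabla^2 f(x)$, $\mathbb E\|\nabla^2 f_{\xi^h_t}(x)-\nabla^2 f(x)\|^2\le\sigma_h^2$, and $\|\nabla^2 f_{\xi^h_t}(x)-\nabla^2 f(x)\|\le\delta_h$ almost surely. At the initial point, $\mathbb E\|g_0-\nabla f(x_0)\|^2\le\sigma_{g,0}^2$ and $\mathbb E\|H_0-\nabla^2 f(x_0)\|^3\le\sigma_{h,0}^3$. **Theorem.** (a) There is a universal constant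 $C$ such that, in this setting, for all $\alpha,\beta\in(0,1]$ and $M\ge L$, $M>0$, with $$\frac{4\sqrt3\,L^{3/2}}{\alpha^3}+\frac{73}{M^{3/2}}\,\frac{9L^3}{\beta^3}-\frac{M^{3/2}}{72}\le 0,\tag{*}$$ the random variable $\mu_M(x_{\rm out})$ is integrable and $$\mathbb E\,\mu_M(x_{\rm out})\le C\Bigl(\frac{\sqrt M F_0}{T}+\frac{\sigma_{h,0}^3}{M^{3/2}\beta T}+\frac{\sigma_{g,0}^{3/2}}{\alpha T}+\frac{\beta^{3/2}\,\tilde\sigma_h^3(\beta)}{M^{3/2}}+\alpha^{3/4}\sigma_g^{3/2}\Bigr),$$ where $\tilde\sigma_h^3(\beta)=(1+\log d)^{3/2}\sigma_h^3+(1+\log d)^3\beta^{3/2}\delta_h^3$. (b) Consequently there is convergence for any noise level (that is, for any batch size): for all $d\ge1$, $L,\Delta,\sigma_g,\sigma_h,\delta_h,\sigma_{g,0},\sigma_{h,0}\ge 0$ and $\varepsilon>0$ there are $\alpha,\beta\in(0,1]$ and $M\ge L$, $M>0$, satisfying (*), and a $T_0\ge1$, such that in this setting $\mathbb E\,\mu_M(x_{\rm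 out})\le\varepsilon$ for all $T\ge T_0$ and all problems with these constants and $F_0\le\Delta$. -/

import Mathlib

open MeasureTheory ProbabilityTheory

universe u v

noncomputable section

namespace CubicNewton

/- The definitions are written for a Euclidean space `E`; the theorem uses them on
`EuclideanSpace ℝ (Fin d)`. -/

variable {E : Type*} [NormedAddCommGroup E] [InnerProductSpace ℝ E] [CompleteSpace E]

/-- `f` is twice differentiable on the whole space. -/
def TwiceDifferentiable (f : E → ℝ) : Prop :=
  Differentiable ℝ f ∧ Differentiable ℝ (gradient f)

/-- The Hessian of `f` at `x`, as the linear operator that is the derivative of the gradient.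
Its operator norm is the spectral norm. -/
def hessian (f : E → ℝ) (x : E) : E →L[ℝ] E :=
  fderiv ℝ (gradient f) x

/-- The smallest eigenvalue (used for Hessians, which are symmetric). -/
def lambdaMin (A : E →L[ℝ] E) : ℝ :=
  sInf {l : ℝ | Module.End.HasEigenvalue (A : E →ₗ[ℝ] E) l}

/-- The second-order accuracy measure
`μ_c(x) = max (‖∇f(x)‖^{3/2}, -λ_min(∇²f(x))³ / c^{3/2})`. -/
def mu (f : E → ℝ) (c : ℝ) (x : E) : ℝ :=
  max (‖gradient f x‖ ^ (3 / 2 : ℝ)) (-(lambdaMin (hessian f x)) ^ 3 / c ^ (3 / 2 : ℝ))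

/-- The objective is twice differentiable, bounded below, and has an `L`-Lipschitz Hessian. -/
structure IsObjective (f : E → ℝ) (L : ℝ) : Prop where
  twice_diff : TwiceDifferentiable f
  bdd_below : BddBelow (Set.range f)
  lipschitz_hessian : ∀ x y, ‖hessian f x - hessian f y‖ ≤ L * ‖x - y‖

/-- The initial gap `F₀ = f(x₀) - inf f`. -/
def gap (f : E → ℝ) (x₀ : E) : ℝ := f x₀ - ⨅ x, f x

/-- The cubically regularized quadratic model `Ω_{M,g,H}(y, x)`. -/
def cubicModel (M : ℝ) (g : E) (H : E →L[ℝ] E) (x y : E) : ℝ :=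
  inner ℝ g (y - x) + 1 / 2 * inner ℝ (H (y - x)) (y - x) + M / 6 * ‖y - x‖ ^ 3

section Stochastic

variable {Ω : Type u} [MeasurableSpace Ω] {Ξ : Type v} [MeasurableSpace Ξ]
  [MeasurableSpace E]

/-- A measurable family of twice differentiable stochastic functions `f_s`, `s ∈ Ξ`. -/
structure IsStochasticFamily (F : Ξ → E → ℝ) : Prop where
  measurable : ∀ x, Measurable fun s => F s x
  twice_diff : ∀ s, TwiceDifferentiable (F s)

/-- The random sample `ξ` gives unbiased gradients of `f` with variance at most `σ²`,
at every point. -/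
structure GradientNoise (P : Measure Ω) (f : E → ℝ) (F : Ξ → E → ℝ)
    (ξ : Ω → Ξ) (σ : ℝ) : Prop where
  integrable : ∀ x, Integrable (fun ω => gradient (F (ξ ω)) x) P
  unbiased : ∀ x, ∫ ω, gradient (F (ξ ω)) x ∂P = gradient f x
  integrable_sq : ∀ x, Integrable (fun ω => ‖gradient (F (ξ ω)) x - gradient f x‖ ^ 2) P
  variance_le : ∀ x, ∫ ω, ‖gradient (F (ξ ω)) x - gradient f x‖ ^ 2 ∂P ≤ σ ^ 2

/-- The random sample `ξ` gives unbiased Hessians of `f` with variance at most `σ²` and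
error almost surely at most `δ`, at every point. -/
structure HessianNoise (P : Measure Ω) (f : E → ℝ) (F : Ξ → E → ℝ)
    (ξ : Ω → Ξ) (σ δ : ℝ) : Prop where
  integrable : ∀ x, Integrable (fun ω => hessian (F (ξ ω)) x) P
  unbiased : ∀ x, ∫ ω, hessian (F (ξ ω)) x ∂P = hessian f x
  integrable_sq : ∀ x, Integrable (fun ω => ‖hessian (F (ξ ω)) x - hessian f x‖ ^ 2) P
  variance_le : ∀ x, ∫ ω, ‖hessian (F (ξ ω)) x - hessian f x‖ ^ 2 ∂P ≤ σ ^ 2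
  bounded : ∀ x, ∀ᵐ ω ∂P, ‖hessian (F (ξ ω)) x - hessian f x‖ ≤ δ

/-- The noise level of the first gradient sample, at the initial point. -/
structure InitialGradientNoise (P : Measure Ω) (f : E → ℝ) (F : Ξ → E → ℝ)
    (ξ : Ω → Ξ) (x₀ : E) (σ : ℝ) : Prop where
  integrable : Integrable (fun ω => ‖gradient (F (ξ ω)) x₀ - gradient f x₀‖ ^ 2) P
  moment_le : ∫ ω, ‖gradient (F (ξ ω)) x₀ - gradient f x₀‖ ^ 2 ∂P ≤ σ ^ 2

/-- The noise level of the first Hessian sample, at the initial point, in third moment. -/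
structure InitialHessianNoise (P : Measure Ω) (f : E → ℝ) (F : Ξ → E → ℝ)
    (ξ : Ω → Ξ) (x₀ : E) (σ : ℝ) : Prop where
  integrable : Integrable (fun ω => ‖hessian (F (ξ ω)) x₀ - hessian f x₀‖ ^ 3) P
  moment_le : ∫ ω, ‖hessian (F (ξ ω)) x₀ - hessian f x₀‖ ^ 3 ∂P ≤ σ ^ 3

/-- The gradient estimates `g_t` with implicit-transport (IT) momentum along a path of
samples `ξ` and iterates `x`. -/
def gradEst (F : Ξ → E → ℝ) (α : ℝ) (ξ : ℕ → Ξ) (x : ℕ → E) : ℕ → E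
  | 0 => gradient (F (ξ 0)) (x 0)
  | t + 1 => (1 - α) • gradEst F α ξ x t +
      α • gradient (F (ξ (t + 1))) (x (t + 1) + ((1 - α) / α) • (x (t + 1) - x t))

/-- The Hessian estimates `H_t` with heavy-ball (HB) momentum along a path of samples `ξ` and
iterates `x`. -/
def hessEst (F : Ξ → E → ℝ) (β : ℝ) (ξ : ℕ → Ξ) (x : ℕ → E) :
    ℕ → E →L[ℝ] E
  | 0 => hessian (F (ξ 0)) (x 0)
  | t + 1 => (1 - β) • hessEst F β ξ x t + β • hessian (F (ξ (t + 1))) (x (t + 1))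

/-- `x₀, x 1, …, x T` are the iterates of `T` steps of Cubic Newton with momentum driven by the
samples `ξg t`, `ξh t`. Here `ℱ t` is the information available before the samples of step `t`
are drawn (it may contain independent randomness used to break ties in the argmin); the two
samples of a step may depend on one another, or be equal. -/
structure IsRun (P : Measure Ω) (ℱ : Filtration ℕ (inferInstance : MeasurableSpace Ω))
    (F : Ξ → E → ℝ) (x₀ : E) (M α β : ℝ) (T : ℕ)
    (ξg ξh : ℕ → Ω → Ξ) (x : ℕ → Ω → E) : Prop where
  start : ∀ ω, x 0 ω = x₀
  adapted : ∀ t ≤ T, Measurable[ℱ t] (x t)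
  measurable_grad_sample : ∀ t < T, Measurable[ℱ (t + 1)] (ξg t)
  measurable_hess_sample : ∀ t < T, Measurable[ℱ (t + 1)] (ξh t)
  indep_grad_sample : ∀ t < T, Indep (MeasurableSpace.comap (ξg t) inferInstance) (ℱ t) P
  indep_hess_sample : ∀ t < T, Indep (MeasurableSpace.comap (ξh t) inferInstance) (ℱ t) P
  cubic_step : ∀ t < T, ∀ ω,
    IsMinOn (cubicModel M
      (gradEst F α (fun s => ξg s ω) (fun s => x s ω) t)
      (hessEst F β (fun s => ξh s ω) (fun s => x s ω) t)
      (x t ω)) Set.univ (x (t + 1) ω)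

/-- `xout` is drawn uniformly at random from `x 1, …, x T`: it is `x τ` for an index `τ` that is
uniform on `{1, …, T}` and independent of the iterates. -/
def IsUniformOutput (P : Measure Ω) (T : ℕ) (x : ℕ → Ω → E) (xout : Ω → E) : Prop :=
  ∃ τ : Ω → ℕ, Measurable τ ∧ P.map τ = uniformOn (Set.Icc 1 T) ∧
    IndepFun τ (fun ω (t : Fin (T + 1)) => x t ω) P ∧ ∀ ω, xout ω = x (τ ω) ω

end Stochastic

/-- The condition that links the momentum parameters `α`, `β` and the regularization `M`. -/
def ParamCondition (L M α β : ℝ) : Prop :=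
  4 * √3 * L ^ (3 / 2 : ℝ) / α ^ 3 + 73 / M ^ (3 / 2 : ℝ) * (9 * L ^ 3 / β ^ 3)
    - M ^ (3 / 2 : ℝ) / 72 ≤ 0

/-- The cube of the effective Hessian noise level in dimension `d` under momentum `β`. -/
def effHessNoiseCube (d : ℕ) (β σh δh : ℝ) : ℝ :=
  (1 + Real.log d) ^ (3 / 2 : ℝ) * σh ^ 3 +
    (1 + Real.log d) ^ 3 * β ^ (3 / 2 : ℝ) * δh ^ 3

/-- The rate: the expression inside the `O(·)`. -/
def rate (d T : ℕ) (F₀ M α β σg0 σh0 σg σh δh : ℝ) : ℝ :=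
  √M * F₀ / T + σh0 ^ 3 / (M ^ (3 / 2 : ℝ) * β * T) + σg0 ^ (3 / 2 : ℝ) / (α * T)
    + β ^ (3 / 2 : ℝ) * effHessNoiseCube d β σh δh / M ^ (3 / 2 : ℝ)
    + α ^ (3 / 4 : ℝ) * σg ^ (3 / 2 : ℝ)

end CubicNewton

end

namespace CubicNewton

/-! ### Taylor estimates for a function with Lipschitz Hessian. -/

section Deterministic

variable {E : Type*} [NormedAddCommGroup E] [InnerProductSpace ℝ E] [CompleteSpace E]
  {f : E → ℝ} {L : ℝ}

/-! One cubic step makes progress even with inexact data. The model drops by at least M/12 times the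
cube of the step length r; Taylor's formula with L ≤ M transfers this to f up to the estimation
errors, and the optimality conditions of the model bound the gradient and the negative curvature at
the new point. Put R = √M r, p = (gradient error)^{1/2}, q = (Hessian error)/√M. All terms are then
homogeneous of degree three in R, p, q, and Young's inequality gives
`IsObjective.cubic_step_progress`, whose left side keeps a spare multiple of r³.

Along each path an estimation error is a moving average of fresh noise plus a bias. The bias
contracts by 1-α or 1-β per step and is driven only by the motion of the iterates: the extrapolated
sampling point cancels the first-order Taylor term, so the gradient drift is O(α L r²/α²), and the
Hessian drift is O(β L r/β). The powers 3/2 and 3 turn both into multiples of r³, which the spare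
term absorbs under (*). This is `IsObjective.sum_mu_le`; the noise level does not enter (*), hence
convergence for any batch size.

The noise averages start at zero and have increments that are centred given the past. For gradients,
orthogonality bounds the second moment by ασ². The operator norm of Hessians is not Hilbertian, so
its square is replaced by a squared Schatten norm of exponent about 2 log d, which dominates it and
is uniformly smooth with constant O(1 + log d) (`exists_isSmoothSqNorm`). The almost sure noise
bound then controls a fourth moment, and Jensen's inequality lowers the moments to the powers 3/2
and 3.

Taking expectations of the telescoped sum gives (a). For (b), a small α tames the gradient noise, a
large M tames the Hessian noise and secures (*), and a large T removes the rest. -/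

lemma TwiceDifferentiable.hasFDerivAt_gradient (hf : TwiceDifferentiable f) (x : E) :
    HasFDerivAt (gradient f) (hessian f x) x :=
  (hf.2 x).hasFDerivAt

lemma TwiceDifferentiable.hasDerivAt_gradient_line (hf : TwiceDifferentiable f) (x h : E) (t : ℝ) :
    HasDerivAt (fun t : ℝ => gradient f (x + t • h)) (hessian f (x + t • h) h) t := by
  have h1 : HasDerivAt (fun t : ℝ => x + t • h) h t := by
    simpa using ((hasDerivAt_id t).smul_const h).const_add x
  exact (hf.hasFDerivAt_gradient (x + t • h)).comp_hasDerivAt t h1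

lemma TwiceDifferentiable.hasDerivAt_line (hf : TwiceDifferentiable f) (x h : E) (t : ℝ) :
    HasDerivAt (fun t : ℝ => f (x + t • h)) (inner ℝ (gradient f (x + t • h)) h) t := by
  have h1 : HasDerivAt (fun t : ℝ => x + t • h) h t := by
    simpa using ((hasDerivAt_id t).smul_const h).const_add x
  exact (hf.1 (x + t • h)).hasGradientAt.hasFDerivAt.comp_hasDerivAt t h1

lemma TwiceDifferentiable.isSymmetric_hessian (hf : TwiceDifferentiable f) (x : E) :
    (hessian f x : E →ₗ[ℝ] E).IsSymmetric := by
  intro u v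
  have h := second_derivative_symmetric (𝕜 := ℝ) (f := f)
    (f' := fun y => InnerProductSpace.toDual ℝ E (gradient f y))
    (f'' := (InnerProductSpace.toDual ℝ E).toContinuousLinearEquiv.toContinuousLinearMap.comp
      (hessian f x)) (x := x)
    (fun y => (hf.1 y).hasGradientAt.hasFDerivAt)
    ((InnerProductSpace.toDual ℝ E).toContinuousLinearEquiv.toContinuousLinearMap.hasFDerivAt.comp
      x (hf.hasFDerivAt_gradient x)) u v
  have h' : inner ℝ (hessian f x u) v = inner ℝ (hessian f x v) u := by simpa using h
  simpa [real_inner_comm] using h'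

lemma IsObjective.norm_gradient_sub_le (hf : IsObjective f L) (x h : E) :
    ‖gradient f (x + h) - gradient f x - hessian f x h‖ ≤ L / 2 * ‖h‖ ^ 2 := by
  have hd : ∀ t : ℝ, HasDerivAt
      (fun t : ℝ => gradient f (x + t • h) - gradient f x - t • hessian f x h)
      (hessian f (x + t • h) h - hessian f x h) t := fun t => by
    simpa using! ((hf.twice_diff.hasDerivAt_gradient_line x h t).sub_const _).sub
      ((hasDerivAt_id t).smul_const (hessian f x h))
  have hB : ∀ t : ℝ, HasDerivAt (fun t : ℝ => L / 2 * ‖h‖ ^ 2 * t ^ 2) (L * ‖h‖ ^ 2 * t) t :=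
    fun t => ((hasDerivAt_pow 2 t).const_mul (L / 2 * ‖h‖ ^ 2)).congr_deriv (by norm_num; ring)
  -- Integration along the segment is replaced by comparing derivatives: the remainder starts at 0
  -- and its derivative is at most L‖h‖²t.
  have := image_norm_le_of_norm_deriv_right_le_deriv_boundary (a := 0) (b := 1)
    (fun t _ => (hd t).continuousAt.continuousWithinAt) (fun t _ => (hd t).hasDerivWithinAt)
    (by simp) hB (fun t ht => ?_) (x := 1) (by simp)
  · simpa using this
  · rw [← sub_apply]
    calc _ ≤ ‖hessian f (x + t • h) - hessian f x‖ * ‖h‖ := ContinuousLinearMap.le_opNorm _ _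
      _ ≤ L * ‖x + t • h - x‖ * ‖h‖ := by gcongr; exact hf.lipschitz_hessian _ _
      _ = L * ‖h‖ ^ 2 * t := by
        rw [add_sub_cancel_left, norm_smul, Real.norm_of_nonneg ht.1]; ring

lemma IsObjective.le_taylor (hf : IsObjective f L) (x h : E) :
    f (x + h) ≤ f x + inner ℝ (gradient f x) h + 1 / 2 * inner ℝ (hessian f x h) h
      + L / 6 * ‖h‖ ^ 3 := by
  have hd : ∀ t : ℝ, HasDerivAt
      (fun t : ℝ => f (x + t • h) - f x - t * inner ℝ (gradient f x) h
        - 1 / 2 * t ^ 2 * inner ℝ (hessian f x h) h)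
      (inner ℝ (gradient f (x + t • h) - gradient f x - hessian f x (t • h)) h) t := fun t => by
    have h1 := ((hasDerivAt_id t).mul_const (inner ℝ (gradient f x) h))
    have h2 := ((hasDerivAt_pow 2 t).const_mul (1 / 2)).mul_const (inner ℝ (hessian f x h) h)
    refine ((((hf.twice_diff.hasDerivAt_line x h t).sub_const (f x)).sub h1).sub h2).congr_deriv ?_
    simp only [inner_sub_left, map_smul, inner_smul_left]
    norm_num
    exact Or.inl (by ring)
  have hB : ∀ t : ℝ, HasDerivAt (fun t : ℝ => L / 6 * ‖h‖ ^ 3 * t ^ 3) (L / 2 * ‖h‖ ^ 3 * t ^ 2) t :=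
    fun t => ((hasDerivAt_pow 3 t).const_mul (L / 6 * ‖h‖ ^ 3)).congr_deriv (by norm_num; ring)
  have := image_norm_le_of_norm_deriv_right_le_deriv_boundary (a := 0) (b := 1)
    (fun t _ => (hd t).continuousAt.continuousWithinAt) (fun t _ => (hd t).hasDerivWithinAt)
    (by simp) hB (fun t ht => ?_) (x := 1) (by simp)
  · have := (abs_le.1 this).2
    simp only [one_smul, one_mul, one_pow, mul_one] at this
    linarith
  · calc _ ≤ ‖gradient f (x + t • h) - gradient f x - hessian f x (t • h)‖ * ‖h‖ :=
        norm_inner_le_norm _ _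
      _ ≤ L / 2 * ‖t • h‖ ^ 2 * ‖h‖ := by gcongr; exact hf.norm_gradient_sub_le _ _
      _ = L / 2 * ‖h‖ ^ 3 * t ^ 2 := by
        rw [norm_smul, Real.norm_of_nonneg ht.1]; ring

end Deterministic

/-! ### Optimality conditions for the cubic model. -/

section CubicStep

variable {E : Type*} [NormedAddCommGroup E] [InnerProductSpace ℝ E]
  {M : ℝ} {g : E} {H : E →L[ℝ] E} {x y : E}

lemma cubicModel_le_of_isMinOn (h : IsMinOn (cubicModel M g H x) Set.univ y) (v : E) :
    inner ℝ g (y - x) + 1 / 2 * inner ℝ (H (y - x)) (y - x) + M / 6 * ‖y - x‖ ^ 3 ≤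
      inner ℝ g v + 1 / 2 * inner ℝ (H v) v + M / 6 * ‖v‖ ^ 3 := by
  simpa [cubicModel] using h (Set.mem_univ (x + v))

lemma hasDerivAt_norm_pow_three_line (h v : E) :
    HasDerivAt (fun t : ℝ => ‖h + t • v‖ ^ 3) (3 * ‖h‖ * inner ℝ h v) 0 := by
  have h1 : HasDerivAt (fun t : ℝ => h + t • v) v 0 := by
    simpa using ((hasDerivAt_id (0 : ℝ)).smul_const v).const_add h
  have h2 := hasFDerivAt_norm_rpow (h + (0 : ℝ) • v) (p := 3) (by norm_num)
  have h3 := h2.comp_hasDerivAt 0 h1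
  have e : (fun t : ℝ => ‖h + t • v‖ ^ 3) = (fun z : E => ‖z‖ ^ (3 : ℝ)) ∘ fun t : ℝ => h + t • v := by
    ext t; exact_mod_cast (Real.rpow_natCast ‖h + t • v‖ 3).symm
  rw [e]
  refine h3.congr_deriv ?_
  norm_num

/-- At a minimizer the derivative along every line vanishes; symmetry of `H` merges the two halves
of the quadratic term. -/
lemma cubicModel_first_order (hH : (H : E →ₗ[ℝ] E).IsSymmetric)
    (h : IsMinOn (cubicModel M g H x) Set.univ y) :
    g + H (y - x) + (M / 2 * ‖y - x‖) • (y - x) = 0 := by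
  set r := y - x with hr
  refine ext_inner_right ℝ fun v => ?_
  have h1 : HasDerivAt (fun t : ℝ => r + t • v) v 0 := by
    simpa using ((hasDerivAt_id (0 : ℝ)).smul_const v).const_add r
  have h2 : HasDerivAt (fun t : ℝ => H (r + t • v)) (H v) 0 :=
    H.hasFDerivAt.comp_hasDerivAt 0 h1
  have h3 := ((((hasDerivAt_const (0 : ℝ) g).inner ℝ h1).add
    ((h2.inner ℝ h1).const_mul (1 / 2))).add ((hasDerivAt_norm_pow_three_line r v).const_mul (M / 6)))
  have hloc : IsLocalMin (fun t : ℝ => inner ℝ g (r + t • v)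
      + 1 / 2 * inner ℝ (H (r + t • v)) (r + t • v) + M / 6 * ‖r + t • v‖ ^ 3) 0 :=
    Filter.Eventually.of_forall fun t => by
      simpa only [zero_smul, add_zero, ← hr] using cubicModel_le_of_isMinOn h (r + t • v)
  have h4 := hloc.hasDerivAt_eq_zero h3
  have hs : inner ℝ (H v) r = inner ℝ (H r) v := by
    rw [real_inner_comm]; exact (hH r v).symm
  simp only [zero_smul, add_zero, inner_zero_left, hs] at h4
  simp only [inner_add_left, inner_smul_left, inner_zero_left]
  simp only [conj_trivial]
  linarith

lemma norm_add_apply_of_isMinOn (hM : 0 < M) (hH : (H : E →ₗ[ℝ] E).IsSymmetric)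
    (h : IsMinOn (cubicModel M g H x) Set.univ y) :
    ‖g + H (y - x)‖ = M / 2 * ‖y - x‖ ^ 2 := by
  rw [eq_neg_of_add_eq_zero_left (cubicModel_first_order hH h), norm_neg, norm_smul,
    Real.norm_of_nonneg (by positivity)]
  ring

/-- With r = y - x, comparison with the reflected step -r gives ⟨g, r⟩ ≤ 0. Pairing the first-order
condition with r eliminates ⟨Hr, r⟩ and leaves the model value ⟨g, r⟩/2 - (M/12)‖r‖³. -/
lemma cubicModel_le_neg_of_isMinOn (hH : (H : E →ₗ[ℝ] E).IsSymmetric)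
    (h : IsMinOn (cubicModel M g H x) Set.univ y) :
    cubicModel M g H x y ≤ -(M / 12) * ‖y - x‖ ^ 3 := by
  have h1 := congrArg (fun z => inner ℝ z (y - x)) (cubicModel_first_order hH h)
  have h2 := cubicModel_le_of_isMinOn h (-(y - x))
  simp only [inner_add_left, inner_smul_left, real_inner_self_eq_norm_sq, inner_zero_left,
    conj_trivial] at h1
  simp only [inner_neg_right, map_neg, inner_neg_left, neg_neg, norm_neg] at h2
  unfold cubicModel
  nlinarith

/-- Comparing the minimizer r with r + w and r - w and adding cancels all terms linear in w. The
parallelogram law bounds the two cubes, and the choice ‖w‖ = ‖r‖ gives the constant M‖r‖, which is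
not sharp but sufficient. -/
lemma inner_apply_ge_of_isMinOn (hM : 0 < M)
    (h : IsMinOn (cubicModel M g H x) Set.univ y) (v : E) :
    -(M * ‖y - x‖) * ‖v‖ ^ 2 ≤ inner ℝ (H v) v := by
  set r := y - x with hr
  have key : ∀ w : E, 0 ≤ inner ℝ (H w) w
      + M / 6 * ((‖r‖ + ‖w‖) * (2 * (‖r‖ ^ 2 + ‖w‖ ^ 2)) - 2 * ‖r‖ ^ 3) := by
    intro w
    have h1 := cubicModel_le_of_isMinOn h (r + w)
    have h2 := cubicModel_le_of_isMinOn h (r - w)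
    rw [← hr] at h1 h2
    have ha := norm_add_le r w
    have hb := norm_sub_le r w
    have h4 : ‖r + w‖ ^ 3 + ‖r - w‖ ^ 3 ≤ (‖r‖ + ‖w‖) * (2 * (‖r‖ ^ 2 + ‖w‖ ^ 2)) := by
      have h3 := parallelogram_law_with_norm ℝ r w
      rw [← h3]
      linarith [mul_le_mul_of_nonneg_right ha (sq_nonneg ‖r + w‖),
        mul_le_mul_of_nonneg_right hb (sq_nonneg ‖r - w‖)]
    simp only [map_add, map_sub, inner_add_left, inner_add_right, inner_sub_left,
      inner_sub_right] at h1 h2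
    linarith [mul_le_mul_of_nonneg_left h4 hM.le]
  rcases eq_or_ne v 0 with rfl | hv
  · simp
  have hv' : 0 < ‖v‖ := norm_pos_iff.2 hv
  rcases eq_or_lt_of_le (norm_nonneg r) with hr0 | hr0
  -- For r = 0 no w of length ‖r‖ has a direction. The scale s is taken so that the cubic term,
  -- divided by s², is exactly ε.
  · refine le_of_forall_pos_le_add fun ε hε => ?_
    have hs : 0 < ε / (M / 3 * ‖v‖ ^ 3) := by positivity
    have := key ((ε / (M / 3 * ‖v‖ ^ 3)) • v)
    rw [← hr0, norm_smul, Real.norm_of_nonneg hs.le, map_smul, inner_smul_left,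
      inner_smul_right, conj_trivial] at this
    rw [← hr0]
    set s := ε / (M / 3 * ‖v‖ ^ 3) with hs'
    have hε' : ε = s * (M / 3 * ‖v‖ ^ 3) := by rw [hs']; field_simp
    have h0 : 0 ≤ s ^ 2 * (inner ℝ (H v) v + ε) := by rw [hε']; linarith
    have := (mul_nonneg_iff_of_pos_left (by positivity)).1 h0
    linarith
  · have hs : 0 < ‖r‖ / ‖v‖ := by positivity
    have := key ((‖r‖ / ‖v‖) • v)
    rw [norm_smul, Real.norm_of_nonneg hs.le, map_smul, inner_smul_left,
      inner_smul_right, conj_trivial] at this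
    set s := ‖r‖ / ‖v‖ with hs'
    have hε' : ‖r‖ = s * ‖v‖ := by rw [hs']; field_simp
    rw [hε'] at this ⊢
    have h0 : 0 ≤ s ^ 2 * (inner ℝ (H v) v + (M * (s * ‖v‖)) * ‖v‖ ^ 2) := by linarith
    have := (mul_nonneg_iff_of_pos_left (by positivity)).1 h0
    linarith

end CubicStep

/-! ### Smallest eigenvalue and progress of one inexact step. -/

section Basic

variable {E : Type*} [NormedAddCommGroup E] [InnerProductSpace ℝ E]

lemma inner_apply_le_norm (A : E →L[ℝ] E) (v : E) : |inner ℝ (A v) v| ≤ ‖A‖ * ‖v‖ ^ 2 := by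
  calc |inner ℝ (A v) v| ≤ ‖A v‖ * ‖v‖ := abs_real_inner_le_norm _ _
    _ ≤ ‖A‖ * ‖v‖ * ‖v‖ := by gcongr; exact A.le_opNorm v
    _ = _ := by ring

variable [CompleteSpace E]

lemma IsObjective.continuous_hessian {f : E → ℝ} {L : ℝ} (hf : IsObjective f L) :
    Continuous (hessian f) :=
  (LipschitzWith.of_dist_le' (K := L) fun x y => by
    simpa only [dist_eq_norm] using hf.lipschitz_hessian x y).continuous

lemma mu_nonneg (f : E → ℝ) (c : ℝ) (x : E) : 0 ≤ mu f c x :=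
  le_max_of_le_left (by positivity)

end Basic

section LambdaMin

variable {E : Type*} [NormedAddCommGroup E] [InnerProductSpace ℝ E] [FiniteDimensional ℝ E]
  [Nontrivial E] {A B : E →L[ℝ] E}

lemma le_lambdaMin (hA : (A : E →ₗ[ℝ] E).IsSymmetric) {c : ℝ}
    (h : ∀ v, c * ‖v‖ ^ 2 ≤ inner ℝ (A v) v) : c ≤ lambdaMin A := by
  refine le_csInf ⟨_, hA.hasEigenvalue_iInf_of_finiteDimensional⟩ ?_
  intro l hl
  obtain ⟨v, hv⟩ := hl.exists_hasEigenvector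
  have h1 := h v
  have h2 : A v = l • v := hv.apply_eq_smul
  have h3 : 0 < ‖v‖ ^ 2 := by have := norm_pos_iff.2 hv.2; positivity
  rw [h2, inner_smul_left, real_inner_self_eq_norm_sq, conj_trivial] at h1
  exact le_of_mul_le_mul_right h1 h3

/-- In finite dimension the infimum of the Rayleigh quotient is itself an eigenvalue, so it lies
above `lambdaMin`; boundedness of the spectrum by ‖A‖ makes both infima meaningful. -/
lemma lambdaMin_mul_le (hA : (A : E →ₗ[ℝ] E).IsSymmetric) (v : E) :
    lambdaMin A * ‖v‖ ^ 2 ≤ inner ℝ (A v) v := by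
  rcases eq_or_ne v 0 with rfl | hv
  · simp
  have hv' : 0 < ‖v‖ := norm_pos_iff.2 hv
  rw [← le_div_iff₀ (by positivity)]
  have hb : BddBelow {l : ℝ | Module.End.HasEigenvalue (A : E →ₗ[ℝ] E) l} := by
    refine ⟨-‖A‖, fun l hl => ?_⟩
    obtain ⟨w, hw⟩ := hl.exists_hasEigenvector
    have h2 : A w = l • w := hw.apply_eq_smul
    have h1 := (abs_le.1 (inner_apply_le_norm A w)).1
    have h3 : 0 < ‖w‖ ^ 2 := by have := norm_pos_iff.2 hw.2; positivity
    rw [h2, inner_smul_left, real_inner_self_eq_norm_sq, conj_trivial, ← neg_mul] at h1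
    exact le_of_mul_le_mul_right h1 h3
  refine (csInf_le hb hA.hasEigenvalue_iInf_of_finiteDimensional).trans ?_
  refine ciInf_le (f := fun x : {x : E // x ≠ 0} =>
    RCLike.re (inner ℝ (A x) (x : E)) / ‖(x : E)‖ ^ 2) ⟨-‖A‖, ?_⟩ ⟨v, hv⟩
  rintro _ ⟨⟨w, hw⟩, rfl⟩
  have hw' : 0 < ‖w‖ := norm_pos_iff.2 hw
  have h1 := (abs_le.1 (inner_apply_le_norm A w)).1
  simp only [RCLike.re_to_real]
  rw [le_div_iff₀ (by positivity)]
  linarith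

/-- Weyl's inequality. It makes `lambdaMin` Lipschitz on symmetric operators, hence `mu` continuous
and measurable. -/
lemma lambdaMin_sub_norm_le (hA : (A : E →ₗ[ℝ] E).IsSymmetric)
    (hB : (B : E →ₗ[ℝ] E).IsSymmetric) : lambdaMin A - ‖A - B‖ ≤ lambdaMin B := by
  refine le_lambdaMin hB fun v => ?_
  have h1 := lambdaMin_mul_le hA v
  have h2 := (abs_le.1 (inner_apply_le_norm (A - B) v)).2
  rw [sub_apply, inner_sub_left] at h2
  linarith

lemma IsObjective.continuous_mu {f : E → ℝ} {L : ℝ} (hf : IsObjective f L) (c : ℝ) :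
    Continuous (mu f c) := by
  have h1 : Continuous (gradient f) := hf.twice_diff.2.continuous
  have h2 : LipschitzWith (Real.toNNReal L) fun x => lambdaMin (hessian f x) := by
    refine LipschitzWith.of_dist_le' fun x y => ?_
    have hs := hf.twice_diff.isSymmetric_hessian
    have a := lambdaMin_sub_norm_le (hs x) (hs y)
    have b := lambdaMin_sub_norm_le (hs y) (hs x)
    have c := hf.lipschitz_hessian x y
    rw [norm_sub_rev] at b
    rw [Real.dist_eq, dist_eq_norm, abs_le]
    constructor <;> linarith
  exact (h1.norm.rpow_const fun _ => Or.inr (by norm_num)).max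
    ((h2.continuous.pow 3).neg.div_const _)

lemma rpow_three_halves_sq {a : ℝ} (ha : 0 ≤ a) : (a ^ 2) ^ (3 / 2 : ℝ) = a ^ 3 := by
  rw [← Real.rpow_natCast, ← Real.rpow_mul ha, ← Real.rpow_natCast]
  norm_num

/-- Progress of one cubic Newton step with inexact gradient `g` and Hessian `H`. -/
lemma IsObjective.cubic_step_progress {f : E → ℝ} {L M : ℝ} (hf : IsObjective f L)
    (hM : 0 < M) (hL : L ≤ M) {g x y : E} {H : E →L[ℝ] E} (hH : (H : E →ₗ[ℝ] E).IsSymmetric)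
    (h : IsMinOn (cubicModel M g H x) Set.univ y) :
    mu f M y / 10000 + M ^ (3 / 2 : ℝ) / 72 * ‖y - x‖ ^ 3 ≤
      √M * (f x - f y) + 4 * ‖g - gradient f x‖ ^ (3 / 2 : ℝ)
        + 73 / M ^ (3 / 2 : ℝ) * ‖H - hessian f x‖ ^ 3 := by
  -- The substitution M = s², with p, q and R below, removes all fractional powers and makes every
  -- estimate homogeneous of degree three.
  obtain ⟨s, hs, rfl⟩ : ∃ s : ℝ, 0 < s ∧ M = s ^ 2 :=
    ⟨√M, Real.sqrt_pos.2 hM, (Real.sq_sqrt hM.le).symm⟩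
  have hfo := norm_add_apply_of_isMinOn hM hH h
  have hmod := cubicModel_le_neg_of_isMinOn hH h
  have hpsd := inner_apply_ge_of_isMinOn hM h
  have htay := hf.le_taylor x (y - x)
  have hgrad := hf.norm_gradient_sub_le x (y - x)
  have hlip := hf.lipschitz_hessian x y
  rw [norm_sub_rev x y] at hlip
  rw [add_sub_cancel] at htay hgrad
  unfold cubicModel at hmod
  set r := y - x with hr
  set p := √‖g - gradient f x‖ with hp
  have hp2 : ‖g - gradient f x‖ = p ^ 2 := (Real.sq_sqrt (norm_nonneg _)).symm
  have hp0 : 0 ≤ p := Real.sqrt_nonneg _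
  set q := ‖H - hessian f x‖ / s with hq
  have hq2 : ‖H - hessian f x‖ = s * q := by rw [hq]; field_simp
  have hq0 : 0 ≤ q := by positivity
  set R := s * ‖r‖ with hR
  have hR0 : 0 ≤ R := by positivity
  have hrn : 0 ≤ ‖r‖ := norm_nonneg r
  have hmu : mu f (s ^ 2) y ≤ (2 * R + p + q) ^ 3 := by
    refine max_le ?_ ?_
    -- The Taylor remainder and the first-order condition contribute R²/2 each, the estimation
    -- errors p² and qR.
    · have h1 : ‖gradient f y‖ ≤ (2 * R + p + q) ^ 2 := by
        have e : gradient f y = (gradient f y - gradient f x - hessian f x r)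
            - (g - gradient f x) - (H - hessian f x) r + (g + H r) := by
          rw [sub_apply]; abel
        have h2 : ‖(H - hessian f x) r‖ ≤ q * R := by
          refine (ContinuousLinearMap.le_opNorm _ _).trans (le_of_eq ?_)
          rw [hq2]; ring
        have h3 : ‖gradient f y‖ ≤ ‖gradient f y - gradient f x - hessian f x r‖
            + ‖g - gradient f x‖ + ‖(H - hessian f x) r‖ + ‖g + H r‖ := by
          conv_lhs => rw [e]
          refine (norm_add_le _ _).trans ?_
          gcongr
          refine (norm_sub_le _ _).trans ?_
          gcongr
          exact norm_sub_le _ _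
        have h4 : L / 2 * ‖r‖ ^ 2 ≤ s ^ 2 / 2 * ‖r‖ ^ 2 := by gcongr
        have h5 : s ^ 2 / 2 * ‖r‖ ^ 2 = R ^ 2 / 2 := by rw [hR]; ring
        nlinarith [mul_nonneg hR0 hp0, mul_nonneg hR0 hq0, mul_nonneg hp0 hq0]
      calc _ ≤ ((2 * R + p + q) ^ 2) ^ (3 / 2 : ℝ) := by gcongr
        _ = _ := rpow_three_halves_sq (by positivity)
    -- One sR comes from the curvature bound of the model, the other from the Hessian's change
    -- between x and y.
    · have h1 : -(s * (2 * R + q)) ≤ lambdaMin (hessian f y) := by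
        refine le_lambdaMin (hf.twice_diff.isSymmetric_hessian y) fun v => ?_
        have h2 := hpsd v
        have h3 := (abs_le.1 (inner_apply_le_norm (H - hessian f x) v)).2
        have h4 := (abs_le.1 (inner_apply_le_norm (hessian f x - hessian f y) v)).2
        rw [sub_apply, inner_sub_left] at h3 h4
        rw [hq2] at h3
        have h5 : ‖hessian f x - hessian f y‖ * ‖v‖ ^ 2 ≤ s ^ 2 * ‖r‖ * ‖v‖ ^ 2 := by
          gcongr
          exact hlip.trans (by gcongr)
        have h6 : s ^ 2 * ‖r‖ = s * R := by rw [hR]; ring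
        rw [h6] at h5 h2
        linarith
      rw [rpow_three_halves_sq hs.le, div_le_iff₀ (by positivity), ← mul_pow, ← Odd.neg_pow (n := 3) (by decide)]
      refine (Odd.pow_le_pow (n := 3) (by decide)).2 ?_
      have := mul_nonneg hs.le hp0
      linarith
  have hdesc : R ^ 3 / 12 - p ^ 2 * R - q * R ^ 2 / 2 ≤ s * (f x - f y) := by
    have h1 := (abs_le.1 (abs_real_inner_le_norm (g - gradient f x) r)).1
    have h2 := (abs_le.1 (inner_apply_le_norm (H - hessian f x) r)).1
    have h3 : L / 6 * ‖r‖ ^ 3 ≤ s ^ 2 / 6 * ‖r‖ ^ 3 := by gcongr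
    rw [hq2, sub_apply, inner_sub_left] at h2
    rw [hp2, inner_sub_left] at h1
    have h4 : s ^ 2 / 12 * ‖r‖ ^ 3 - p ^ 2 * ‖r‖ - s * q * ‖r‖ ^ 2 / 2 ≤ f x - f y := by
      linarith
    have h5 := mul_le_mul_of_nonneg_left h4 hs.le
    rw [hR]
    linarith
  have e1 : (p ^ 2) ^ (3 / 2 : ℝ) = p ^ 3 := rpow_three_halves_sq hp0
  have e2 : (s ^ 2) ^ (3 / 2 : ℝ) = s ^ 3 := rpow_three_halves_sq hs.le
  have e3 : 73 / s ^ 3 * (s * q) ^ 3 = 73 * q ^ 3 := by field_simp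
  have e4 : s ^ 3 / 72 * ‖r‖ ^ 3 = R ^ 3 / 72 := by rw [hR]; ring
  rw [hp2, hq2, e1, e2, e3, e4, Real.sqrt_sq hs.le]
  have c1 : (2 * R + p + q) ^ 3 ≤ 32 * R ^ 3 + 16 * p ^ 3 + 16 * q ^ 3 := by
    have h1 := add_pow_le (by positivity : 0 ≤ 2 * R) (add_nonneg hp0 hq0) 3
    have h2 := add_pow_le hp0 hq0 3
    norm_num at h1 h2
    rw [add_assoc]
    linarith
  -- Young's inequalities in polynomial form: the cubic with a double root near the optimal ratio of
  -- the variables is nonnegative. The two bounds use 2/36 of the available R³/12; of the remaining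
  -- R³/36, half is kept as the step-length term and half pays for 32R³/10000.
  have c2 : p ^ 2 * R ≤ R ^ 3 / 36 + 3 * p ^ 3 := by
    have := mul_nonneg (add_nonneg hR0 (mul_nonneg (by norm_num : (0:ℝ) ≤ 7) hp0)) (sq_nonneg (2 * R - 7 * p))
    nlinarith [pow_nonneg hp0 3]
  have c3 : q * R ^ 2 / 2 ≤ R ^ 3 / 36 + 24 * q ^ 3 := by
    have := mul_nonneg (add_nonneg hR0 (mul_nonneg (by norm_num : (0:ℝ) ≤ 6) hq0)) (sq_nonneg (R - 12 * q))
    linarith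
  have : 0 ≤ R ^ 3 := by positivity
  have : 0 ≤ p ^ 3 := by positivity
  have : 0 ≤ q ^ 3 := by positivity
  linarith

end LambdaMin

/-! ### Uniform smoothness of squared Schatten norms. -/

section Schatten

/-- The terms of index r and n - r are paired; by the rearrangement inequality for |a| and |b| each
pair is at most aⁿ + bⁿ. Evenness of n removes the absolute values. -/
lemma sum_range_pow_mul_pow_le (a b : ℝ) (n : ℕ) (hn : Even n) :
    ∑ r ∈ Finset.range (n + 1), a ^ r * b ^ (n - r) ≤ (n + 1) / 2 * (a ^ n + b ^ n) := by
  have h1 : ∀ r ∈ Finset.range (n + 1), a ^ r * b ^ (n - r) + a ^ (n - r) * b ^ r ≤ a ^ n + b ^ n := by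
    intro r hr
    have hr' : r ≤ n := Nat.lt_succ_iff.1 (Finset.mem_range.1 hr)
    have e : ∀ x y : ℝ, x ^ r * y ^ (n - r) ≤ |x| ^ r * |y| ^ (n - r) := fun x y => by
      rw [← abs_pow, ← abs_pow, ← abs_mul]; exact le_abs_self _
    have h2 := e a b
    have h3 := e b a
    have ea : a ^ n = |a| ^ r * |a| ^ (n - r) := by
      rw [← pow_add, Nat.add_sub_cancel' hr', hn.pow_abs]
    have eb : b ^ n = |b| ^ r * |b| ^ (n - r) := by
      rw [← pow_add, Nat.add_sub_cancel' hr', hn.pow_abs]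
    have h4 : 0 ≤ (|a| ^ r - |b| ^ r) * (|a| ^ (n - r) - |b| ^ (n - r)) := by
      rcases le_total |a| |b| with h | h
      · exact mul_nonneg_of_nonpos_of_nonpos (sub_nonpos.2 (by gcongr)) (sub_nonpos.2 (by gcongr))
      · exact mul_nonneg (sub_nonneg.2 (by gcongr)) (sub_nonneg.2 (by gcongr))
    rw [ea, eb]
    linarith
  have h2 := Finset.sum_le_sum h1
  rw [Finset.sum_add_distrib, Finset.sum_const, Finset.card_range, nsmul_eq_mul] at h2
  have h3 : ∑ r ∈ Finset.range (n + 1), a ^ (n - r) * b ^ r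
      = ∑ r ∈ Finset.range (n + 1), a ^ r * b ^ (n - r) := by
    rw [← Finset.sum_range_reflect]
    refine Finset.sum_congr rfl fun r hr => ?_
    have hr' : r ≤ n := Nat.lt_succ_iff.1 (Finset.mem_range.1 hr)
    simp only [Nat.add_sub_cancel, Nat.sub_sub_self hr']
  rw [h3] at h2
  push_cast at h2
  linarith

lemma le_of_second_deriv_le {φ φ' φ'' : ℝ → ℝ} {K : ℝ} (h1 : ∀ t, HasDerivAt φ (φ' t) t)
    (h2 : ∀ t, HasDerivAt φ' (φ'' t) t) (h3 : ∀ t, φ'' t ≤ 2 * K) : φ 1 ≤ φ 0 + φ' 0 + K := by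
  have a : ∀ t ∈ Set.Icc (0 : ℝ) 1, φ' t ≤ φ' 0 + 2 * K * t :=
    image_le_of_deriv_right_le_deriv_boundary
      (fun t _ => (h2 t).continuousAt.continuousWithinAt) (fun t _ => (h2 t).hasDerivWithinAt)
      (by simp) (by fun_prop)
      (fun t _ => (((hasDerivAt_id t).const_mul (2 * K)).const_add (φ' 0)).hasDerivWithinAt)
      (fun t _ => by simpa using h3 t)
  have b := image_le_of_deriv_right_le_deriv_boundary (a := 0) (b := 1)
      (B := fun t => φ 0 + t * φ' 0 + K * t ^ 2)
      (fun t _ => (h1 t).continuousAt.continuousWithinAt) (fun t _ => (h1 t).hasDerivWithinAt)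
      (by simp) (by fun_prop)
      (fun t _ => ((((hasDerivAt_id t).mul_const (φ' 0)).const_add (φ 0)).add
        ((hasDerivAt_pow 2 t).const_mul K)).hasDerivWithinAt)
      (fun t ht => by have := a t ⟨ht.1, ht.2.le⟩; norm_num; linarith)
      (Set.right_mem_Icc.2 zero_le_one)
  simpa using b

variable {E : Type*} [NormedAddCommGroup E] [InnerProductSpace ℝ E] [FiniteDimensional ℝ E]

/-- The trace as a continuous linear functional. -/
noncomputable def traceCLM : (E →L[ℝ] E) →L[ℝ] ℝ :=
  LinearMap.toContinuousLinearMap ((LinearMap.trace ℝ E).comp (ContinuousLinearMap.coeLM ℝ))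

lemma traceCLM_eq_sum {ι : Type*} [Fintype ι] (b : OrthonormalBasis ι ℝ E) (A : E →L[ℝ] E) :
    traceCLM A = ∑ i, inner ℝ (b i) (A (b i)) :=
  LinearMap.trace_eq_sum_inner _ b

lemma traceCLM_mul_comm (A B : E →L[ℝ] E) : traceCLM (A * B) = traceCLM (B * A) :=
  LinearMap.trace_mul_comm ℝ (A : E →ₗ[ℝ] E) B

/-- Diagonalization in the only form needed: pairing with a basis vector turns powers of A into
powers of an eigenvalue. -/
lemma exists_eigenbasis {A : E →L[ℝ] E} (hA : (A : E →ₗ[ℝ] E).IsSymmetric) :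
    ∃ (b : OrthonormalBasis (Fin (Module.finrank ℝ E)) ℝ E) (a : Fin (Module.finrank ℝ E) → ℝ),
      ∀ i (m : ℕ) v, inner ℝ (b i) ((A ^ m) v) = a i ^ m * inner ℝ (b i) v := by
  refine ⟨hA.eigenvectorBasis rfl, hA.eigenvalues rfl, fun i m => ?_⟩
  have h1 : ∀ v, inner ℝ (hA.eigenvectorBasis rfl i) (A v)
      = hA.eigenvalues rfl i * inner ℝ (hA.eigenvectorBasis rfl i) v := fun v => by
    have h2 := hA (hA.eigenvectorBasis rfl i) v
    rw [hA.apply_eigenvectorBasis rfl i, inner_smul_left] at h2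
    simpa using h2.symm
  induction m with
  | zero => simp
  | succ m ih =>
    intro v
    rw [pow_succ', mul_apply_eq_comp, h1, ih]
    ring

lemma traceCLM_pow_eq_sum {A : E →L[ℝ] E} {ι : Type*} [Fintype ι] {b : OrthonormalBasis ι ℝ E}
    {a : ι → ℝ} (h : ∀ i (m : ℕ) v, inner ℝ (b i) ((A ^ m) v) = a i ^ m * inner ℝ (b i) v) (m : ℕ) :
    traceCLM (A ^ m) = ∑ i, a i ^ m := by
  rw [traceCLM_eq_sum b]
  exact Finset.sum_congr rfl fun i _ => by
    rw [h, real_inner_self_eq_norm_sq, b.norm_eq_one]; ring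

lemma traceCLM_mul_mul_eq_sum {A Z : E →L[ℝ] E} (hZ : (Z : E →ₗ[ℝ] E).IsSymmetric)
    {ι : Type*} [Fintype ι] {b : OrthonormalBasis ι ℝ E}
    {a : ι → ℝ} (h : ∀ i (m : ℕ) v, inner ℝ (b i) ((A ^ m) v) = a i ^ m * inner ℝ (b i) v)
    (r s : ℕ) :
    traceCLM (A ^ r * Z * A ^ s * Z) = ∑ i, ∑ j, a i ^ r * a j ^ s * inner ℝ (b j) (Z (b i)) ^ 2 := by
  rw [traceCLM_eq_sum b]
  refine Finset.sum_congr rfl fun i _ => ?_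
  have e1 : inner ℝ (b i) ((A ^ r * Z * A ^ s * Z) (b i))
      = a i ^ r * inner ℝ (Z (b i)) ((A ^ s) (Z (b i))) := by
    simp only [mul_apply_eq_comp]
    rw [h]
    congr 1
    exact (hZ _ _).symm
  rw [e1, ← b.sum_inner_mul_inner, Finset.mul_sum]
  refine Finset.sum_congr rfl fun j _ => ?_
  rw [h, real_inner_comm]
  ring

/-- The left side is, up to a factor, the second derivative of the trace of a power along Z. In an
eigenbasis of A it is a double sum weighted by the squared entries of Z. These are symmetric in the
two indices, and each row sums to the squared length of the image of a unit vector, at most ‖Z‖². -/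
lemma sum_traceCLM_le {A Z : E →L[ℝ] E} (hA : (A : E →ₗ[ℝ] E).IsSymmetric)
    (hZ : (Z : E →ₗ[ℝ] E).IsSymmetric) {n : ℕ} (hn : Even n) :
    ∑ r ∈ Finset.range (n + 1), traceCLM (A ^ r * Z * A ^ (n - r) * Z)
      ≤ (n + 1) * ‖Z‖ ^ 2 * traceCLM (A ^ n) := by
  obtain ⟨b, a, h⟩ := exists_eigenbasis hA
  have hc : ∀ i j, inner ℝ (b j) (Z (b i)) ^ 2 = inner ℝ (b i) (Z (b j)) ^ 2 := fun i j => by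
    have := hZ (b i) (b j)
    rw [real_inner_comm]
    exact congrArg (· ^ 2) this
  have hrow : ∀ i, ∑ j, inner ℝ (b j) (Z (b i)) ^ 2 ≤ ‖Z‖ ^ 2 := fun i => by
    rw [b.sum_sq_inner_right]
    have := Z.le_opNorm (b i)
    rw [b.norm_eq_one, mul_one] at this
    gcongr
  rw [traceCLM_pow_eq_sum h]
  simp only [traceCLM_mul_mul_eq_sum hZ h]
  calc _ = ∑ i, ∑ j, (∑ r ∈ Finset.range (n + 1), a i ^ r * a j ^ (n - r))
          * inner ℝ (b j) (Z (b i)) ^ 2 := by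
        rw [Finset.sum_comm]
        refine Finset.sum_congr rfl fun i _ => ?_
        rw [Finset.sum_comm]
        simp only [Finset.sum_mul]
    _ ≤ ∑ i, ∑ j, ((n + 1) / 2 * (a i ^ n + a j ^ n)) * inner ℝ (b j) (Z (b i)) ^ 2 := by
        gcongr
        exact sum_range_pow_mul_pow_le _ _ n hn
    _ = (n + 1) / 2 * (∑ i, a i ^ n * ∑ j, inner ℝ (b j) (Z (b i)) ^ 2)
        + (n + 1) / 2 * (∑ j, a j ^ n * ∑ i, inner ℝ (b j) (Z (b i)) ^ 2) := by
        simp only [Finset.mul_sum]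
        conv_rhs => rw [Finset.sum_comm (s := Finset.univ) (t := Finset.univ)
          (f := fun j i => (n + 1 : ℝ) / 2 * (a j ^ n * inner ℝ (b j) (Z (b i)) ^ 2))]
        rw [← Finset.sum_add_distrib]
        refine Finset.sum_congr rfl fun i _ => ?_
        rw [← Finset.sum_add_distrib]
        refine Finset.sum_congr rfl fun j _ => ?_
        ring
    _ = (n + 1) * (∑ i, a i ^ n * ∑ j, inner ℝ (b j) (Z (b i)) ^ 2) := by
        have e : ∀ j, ∑ i, inner ℝ (b j) (Z (b i)) ^ 2 = ∑ i, inner ℝ (b i) (Z (b j)) ^ 2 :=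
          fun j => Finset.sum_congr rfl fun i _ => hc i j
        simp only [e]
        ring
    _ ≤ (n + 1) * (∑ i, a i ^ n * ‖Z‖ ^ 2) := by
        gcongr with i
        · exact hn.pow_nonneg _
        · exact hrow i
    _ = _ := by rw [← Finset.sum_mul]; ring

lemma traceCLM_pow_nonneg {A : E →L[ℝ] E} (hA : (A : E →ₗ[ℝ] E).IsSymmetric) {n : ℕ}
    (hn : Even n) : 0 ≤ traceCLM (A ^ n) := by
  obtain ⟨b, a, h⟩ := exists_eigenbasis hA
  rw [traceCLM_pow_eq_sum h]
  exact Finset.sum_nonneg fun i _ => hn.pow_nonneg _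

/-- Hölder's inequality against the constant 1, with exponents k and k/(k-1). This is where the
dimension enters. -/
lemma traceCLM_pow_le {A : E →L[ℝ] E} (hA : (A : E →ₗ[ℝ] E).IsSymmetric) {k : ℕ} (hk : 2 ≤ k) :
    traceCLM (A ^ (2 * k - 2)) ≤ (Module.finrank ℝ E : ℝ) ^ (1 / k : ℝ)
      * traceCLM (A ^ (2 * k)) ^ (1 - 1 / k : ℝ) := by
  obtain ⟨b, a, h⟩ := exists_eigenbasis hA
  rw [traceCLM_pow_eq_sum h, traceCLM_pow_eq_sum h]
  have hk' : (1 : ℝ) < k := by exact_mod_cast hk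
  have hpq := Real.HolderConjugate.conjExponent hk'
  have h1 := Real.inner_le_Lp_mul_Lq_of_nonneg Finset.univ hpq
    (f := fun _ : Fin (Module.finrank ℝ E) => (1 : ℝ)) (g := fun i => a i ^ (2 * k - 2))
    (fun _ _ => zero_le_one) (fun i _ => Even.pow_nonneg ⟨k - 1, by omega⟩ _)
  have e1 : 1 / Real.conjExponent (k : ℝ) = 1 - 1 / k := by
    rw [Real.conjExponent]; field_simp
  have e2 : ∀ i, (a i ^ (2 * k - 2)) ^ Real.conjExponent (k : ℝ) = a i ^ (2 * k) := fun i => by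
    have : a i ^ (2 * k - 2) = (|a i| ^ 2) ^ ((k : ℝ) - 1) := by
      rw [show (k : ℝ) - 1 = ((k - 1 : ℕ) : ℝ) by push_cast [Nat.cast_sub (by omega : 1 ≤ k)]; ring,
        Real.rpow_natCast, ← pow_mul, show 2 * (k - 1) = 2 * k - 2 by omega,
        Even.pow_abs ⟨k - 1, by omega⟩]
    rw [this, ← Real.rpow_mul (by positivity), Real.conjExponent,
      show ((k : ℝ) - 1) * (k / (k - 1)) = k by field_simp [(sub_pos.2 hk').ne'],
      Real.rpow_natCast, sq_abs, pow_mul]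
  simp only [one_mul, Real.one_rpow, Finset.sum_const, Finset.card_univ, Fintype.card_fin,
    nsmul_eq_mul, mul_one, e1, e2] at h1
  exact h1

end Schatten

section Line

variable {E : Type*} [NormedAddCommGroup E] [InnerProductSpace ℝ E]

lemma hasDerivAt_pow_line (X Z : E →L[ℝ] E) (m : ℕ) (t : ℝ) :
    HasDerivAt (fun t : ℝ => (X + t • Z) ^ (m + 1))
      (∑ i ∈ Finset.range (m + 1), (X + t • Z) ^ (m - i) * Z * (X + t • Z) ^ i) t := by
  have h1 : HasDerivAt (fun t : ℝ => X + t • Z) Z t := by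
    simpa using ((hasDerivAt_id t).smul_const Z).const_add X
  exact h1.fun_pow' (m + 1)

lemma isSymmetric_line {X Z : E →L[ℝ] E} (hX : (X : E →ₗ[ℝ] E).IsSymmetric)
    (hZ : (Z : E →ₗ[ℝ] E).IsSymmetric) (t : ℝ) :
    ((X + t • Z : E →L[ℝ] E) : E →ₗ[ℝ] E).IsSymmetric :=
  hX.add (hZ.smul (by simp))

/-- A squared norm on symmetric operators that is 2-uniformly smooth with constant `K`
and dominates the squared operator norm. -/
structure IsSmoothSqNorm (ψ : (E →L[ℝ] E) → ℝ) (K : ℝ) : Prop where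
  pos : 0 < K
  continuous : Continuous ψ
  sq_norm_le : ∀ A : E →L[ℝ] E, (A : E →ₗ[ℝ] E).IsSymmetric → ‖A‖ ^ 2 ≤ ψ A
  smul : ∀ A : E →L[ℝ] E, (A : E →ₗ[ℝ] E).IsSymmetric → ∀ c : ℝ, 0 ≤ c → ψ (c • A) = c ^ 2 * ψ A
  smooth : ∀ X : E →L[ℝ] E, (X : E →ₗ[ℝ] E).IsSymmetric → ∃ ℓ : (E →L[ℝ] E) →L[ℝ] ℝ,
    ∀ Z : E →L[ℝ] E, (Z : E →ₗ[ℝ] E).IsSymmetric → ψ (X + Z) ≤ ψ X + ℓ Z + K * ‖Z‖ ^ 2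

lemma IsSmoothSqNorm.nonneg {ψ : (E →L[ℝ] E) → ℝ} {K : ℝ} (h : IsSmoothSqNorm ψ K)
    {A : E →L[ℝ] E} (hA : (A : E →ₗ[ℝ] E).IsSymmetric) : 0 ≤ ψ A :=
  (sq_nonneg _).trans (h.sq_norm_le A hA)

end Line

section SchattenSmooth

variable {E : Type*} [NormedAddCommGroup E] [InnerProductSpace ℝ E] [FiniteDimensional ℝ E]

lemma hasDerivAt_traceCLM_pow_line (X Z : E →L[ℝ] E) (m : ℕ) (t : ℝ) :
    HasDerivAt (fun t : ℝ => traceCLM ((X + t • Z) ^ (m + 1)))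
      ((m + 1) * traceCLM ((X + t • Z) ^ m * Z)) t := by
  refine (traceCLM.hasFDerivAt.comp_hasDerivAt t (hasDerivAt_pow_line X Z m t)).congr_deriv ?_
  rw [map_sum, Finset.sum_congr rfl (g := fun _ => traceCLM ((X + t • Z) ^ m * Z))]
  · simp
  · intro i hi
    have hi' : i ≤ m := Nat.lt_succ_iff.1 (Finset.mem_range.1 hi)
    rw [traceCLM_mul_comm, ← mul_assoc, ← pow_add, Nat.add_sub_cancel' hi']

lemma hasDerivAt_traceCLM_pow_mul_line (X Z : E →L[ℝ] E) (m : ℕ) (t : ℝ) :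
    HasDerivAt (fun t : ℝ => traceCLM ((X + t • Z) ^ (m + 1) * Z))
      (∑ i ∈ Finset.range (m + 1), traceCLM ((X + t • Z) ^ i * Z * (X + t • Z) ^ (m - i) * Z)) t := by
  refine (traceCLM.hasFDerivAt.comp_hasDerivAt t
    ((hasDerivAt_pow_line X Z m t).mul_const Z)).congr_deriv ?_
  rw [Finset.sum_mul, map_sum, ← Finset.sum_range_reflect]
  refine Finset.sum_congr rfl fun i hi => ?_
  have hi' : i ≤ m := Nat.lt_succ_iff.1 (Finset.mem_range.1 hi)
  simp only [Nat.add_sub_cancel, Nat.sub_sub_self hi']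

/-- A second-order Taylor bound for φ = h^{1/k} on the segment from X to X + Z. In φ'' the term with
h'² has the factor 1/k - 1 ≤ 0 and is dropped; in the other, Hölder bounds h'' by a multiple of
h^{1-1/k}, which cancels h^{1/k-1}. The shift ε keeps h positive, since the root is not smooth at 0.
-/
lemma rpow_traceCLM_add_le {X Z : E →L[ℝ] E} (hX : (X : E →ₗ[ℝ] E).IsSymmetric)
    (hZ : (Z : E →ₗ[ℝ] E).IsSymmetric) {k : ℕ} (hk : 2 ≤ k) {ε : ℝ} (hε : 0 < ε) :
    (traceCLM ((X + Z) ^ (2 * k)) + ε) ^ (1 / k : ℝ) ≤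
      (traceCLM (X ^ (2 * k)) + ε) ^ (1 / k : ℝ)
      + 2 * (traceCLM (X ^ (2 * k)) + ε) ^ (1 / k - 1 : ℝ) * traceCLM (X ^ (2 * k - 1) * Z)
      + (2 * k - 1) * (Module.finrank ℝ E : ℝ) ^ (1 / k : ℝ) * ‖Z‖ ^ 2 := by
  obtain ⟨n, rfl⟩ : ∃ n, k = n + 2 := ⟨k - 2, by omega⟩
  set k := n + 2 with hkn
  have e2 : 2 * k = (2 * n + 2) + 1 + 1 := by omega
  have hk0 : (0 : ℝ) < k := by positivity
  set d : ℝ := (Module.finrank ℝ E : ℝ) ^ (1 / k : ℝ) with hd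
  set h : ℝ → ℝ := fun t => traceCLM ((X + t • Z) ^ (2 * k)) + ε with hh
  set h' : ℝ → ℝ := fun t => 2 * k * traceCLM ((X + t • Z) ^ (2 * n + 2 + 1) * Z) with hh'
  set h'' : ℝ → ℝ := fun t => 2 * k * ∑ i ∈ Finset.range (2 * n + 2 + 1),
    traceCLM ((X + t • Z) ^ i * Z * (X + t • Z) ^ (2 * n + 2 - i) * Z) with hh''
  have hs := isSymmetric_line hX hZ
  have hpos : ∀ t, 0 < h t := fun t =>
    add_pos_of_nonneg_of_pos (traceCLM_pow_nonneg (hs t) (even_two_mul k)) hε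
  have d1 : ∀ t, HasDerivAt h (h' t) t := fun t => by
    have := (hasDerivAt_traceCLM_pow_line X Z (2 * n + 2 + 1) t).add_const ε
    simp only [hh, e2]
    refine this.congr_deriv ?_
    simp only [hh', hkn]; push_cast; ring
  have d2 : ∀ t, HasDerivAt h' (h'' t) t := fun t =>
    (hasDerivAt_traceCLM_pow_mul_line X Z (2 * n + 2) t).const_mul _
  have key := le_of_second_deriv_le (K := (2 * k - 1) * d * ‖Z‖ ^ 2)
    (fun t => (d1 t).rpow_const (p := (1 / k : ℝ)) (Or.inl (hpos t).ne'))
    (fun t => ((d2 t).mul_const (1 / k : ℝ)).mul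
      ((d1 t).rpow_const (p := (1 / k - 1 : ℝ)) (Or.inl (hpos t).ne'))) ?_
  · have e3 : 2 * k - 1 = 2 * n + 2 + 1 := by omega
    simp only [hh, hh', one_smul, zero_smul, add_zero] at key
    rw [e3]
    refine key.trans (le_of_eq ?_)
    field_simp
  · intro t
    have b1 : h'' t ≤ 2 * k * ((2 * k - 1) * ‖Z‖ ^ 2 * (d * h t ^ (1 - 1 / k : ℝ))) := by
      have s1 := sum_traceCLM_le (hs t) hZ (n := 2 * n + 2) ⟨n + 1, by ring⟩
      have s2 := traceCLM_pow_le (hs t) hk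
      rw [show 2 * k - 2 = 2 * n + 2 by omega] at s2
      have s3 : traceCLM ((X + t • Z) ^ (2 * k)) ^ (1 - 1 / k : ℝ) ≤ h t ^ (1 - 1 / k : ℝ) := by
        refine Real.rpow_le_rpow (traceCLM_pow_nonneg (hs t) (even_two_mul k)) ?_ ?_
        · simp only [hh]; linarith
        · rw [sub_nonneg, div_le_one hk0]
          exact_mod_cast (by omega : 1 ≤ k)
      have e4 : ((2 * n + 2 : ℕ) : ℝ) + 1 = 2 * k - 1 := by rw [hkn]; push_cast; ring
      rw [e4] at s1
      have h21 : (0 : ℝ) ≤ 2 * k - 1 := by rw [← e4]; positivity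
      simp only [hh'']
      gcongr
      refine s1.trans ?_
      gcongr
      exact s2.trans (by gcongr)
    have b2 : h t ^ (1 - 1 / k : ℝ) * h t ^ (1 / k - 1 : ℝ) = 1 := by
      rw [← Real.rpow_add (hpos t)]; simp
    have b3 : 0 ≤ h t ^ (1 / k - 1 : ℝ) := by have := hpos t; positivity
    have b4 : 0 ≤ h t ^ (1 / k - 1 - 1 : ℝ) := by have := hpos t; positivity
    have b5 : h'' t * (1 / k) * h t ^ (1 / k - 1 : ℝ) ≤ 2 * ((2 * k - 1) * d * ‖Z‖ ^ 2) := by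
      calc _ ≤ 2 * k * ((2 * k - 1) * ‖Z‖ ^ 2 * (d * h t ^ (1 - 1 / k : ℝ))) * (1 / k)
            * h t ^ (1 / k - 1 : ℝ) := by gcongr
        _ = 2 * ((2 * k - 1) * d * ‖Z‖ ^ 2) * (h t ^ (1 - 1 / k : ℝ) * h t ^ (1 / k - 1 : ℝ)) := by
          field_simp
        _ = _ := by rw [b2, mul_one]
    have b6 : h' t * (1 / k) * (h' t * (1 / k - 1) * h t ^ (1 / k - 1 - 1 : ℝ)) ≤ 0 := by
      have : (1 / k - 1 : ℝ) ≤ 0 := by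
        rw [sub_nonpos, div_le_one hk0]
        exact_mod_cast (by omega : 1 ≤ k)
      have : 0 ≤ (h' t) ^ 2 * (1 / k) * h t ^ (1 / k - 1 - 1 : ℝ) := by positivity
      nlinarith
    linarith

/-- A vanishing trace of an even power forces all eigenvalues to vanish. This settles the degenerate
case X = 0 in the limit ε → 0 below. -/
lemma traceCLM_pow_mul_eq_zero {X : E →L[ℝ] E} (hX : (X : E →ₗ[ℝ] E).IsSymmetric) {k : ℕ}
    (hk : 2 ≤ k) (h : traceCLM (X ^ (2 * k)) = 0) (Z : E →L[ℝ] E) :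
    traceCLM (X ^ (2 * k - 1) * Z) = 0 := by
  obtain ⟨b, a, hb⟩ := exists_eigenbasis hX
  rw [traceCLM_pow_eq_sum hb, Finset.sum_eq_zero_iff_of_nonneg
    fun i _ => (even_two_mul k).pow_nonneg _] at h
  rw [traceCLM_eq_sum b]
  refine Finset.sum_eq_zero fun i hi => ?_
  rw [mul_apply_eq_comp, hb, eq_zero_of_pow_eq_zero (h i hi), zero_pow (by omega), zero_mul]

/-- The squared Schatten norm of exponent `2 * k`. -/
noncomputable def schattenSq (k : ℕ) (A : E →L[ℝ] E) : ℝ :=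
  traceCLM (A ^ (2 * k)) ^ (1 / k : ℝ)

lemma sq_norm_le_schattenSq {A : E →L[ℝ] E} (hA : (A : E →ₗ[ℝ] E).IsSymmetric) {k : ℕ}
    (hk : 2 ≤ k) : ‖A‖ ^ 2 ≤ schattenSq k A := by
  obtain ⟨b, a, hb⟩ := exists_eigenbasis hA
  have h0 : 0 ≤ schattenSq k A :=
    Real.rpow_nonneg (traceCLM_pow_nonneg hA (even_two_mul k)) _
  have h1 : ∀ i, a i ^ 2 ≤ schattenSq k A := fun i => by
    have : (a i ^ 2) ^ (k : ℝ) ≤ traceCLM (A ^ (2 * k)) := by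
      rw [traceCLM_pow_eq_sum hb, Real.rpow_natCast, ← pow_mul]
      exact Finset.single_le_sum (f := fun i => a i ^ (2 * k))
        (fun i _ => (even_two_mul k).pow_nonneg _) (Finset.mem_univ i)
    unfold schattenSq
    rw [one_div, Real.le_rpow_inv_iff_of_pos (by positivity)
      (traceCLM_pow_nonneg hA (even_two_mul k)) (by positivity)]
    exact this
  rw [← Real.sqrt_le_sqrt_iff h0, Real.sqrt_sq (norm_nonneg _)]
  refine ContinuousLinearMap.opNorm_le_bound _ (Real.sqrt_nonneg _) fun v => ?_
  rw [← Real.sqrt_sq (norm_nonneg v), ← Real.sqrt_mul h0, ← Real.sqrt_sq (norm_nonneg (A v))]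
  refine Real.sqrt_le_sqrt ?_
  rw [← b.sum_sq_inner_right, ← b.sum_sq_inner_right, Finset.mul_sum]
  refine Finset.sum_le_sum fun i _ => ?_
  have := hb i 1 v
  rw [pow_one, pow_one] at this
  rw [this, mul_pow]
  exact mul_le_mul_of_nonneg_right (h1 i) (sq_nonneg _)

lemma isSmoothSqNorm_schattenSq (hE : 1 ≤ Module.finrank ℝ E) {k : ℕ} (hk : 2 ≤ k) :
    IsSmoothSqNorm (schattenSq k : (E →L[ℝ] E) → ℝ)
      ((2 * k - 1) * (Module.finrank ℝ E : ℝ) ^ (1 / k : ℝ)) where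
  pos := by
    have h1 : (2 : ℝ) ≤ k := by exact_mod_cast hk
    have h2 : (1 : ℝ) ≤ Module.finrank ℝ E := by exact_mod_cast hE
    exact mul_pos (by linarith) (by positivity)
  continuous := (traceCLM.continuous.comp (continuous_pow _)).rpow_const
    fun _ => Or.inr (by positivity)
  sq_norm_le A hA := sq_norm_le_schattenSq hA hk
  smul A hA c hc := by
    unfold schattenSq
    rw [smul_pow, map_smul, smul_eq_mul, Real.mul_rpow (by positivity)
      (traceCLM_pow_nonneg hA (even_two_mul k)), pow_mul, ← Real.rpow_natCast (c ^ 2) k,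
      ← Real.rpow_mul (by positivity), mul_one_div_cancel (by positivity), Real.rpow_one]
  smooth X hX := by
    have hk0 : (0 : ℝ) < k := by positivity
    -- The functional is the limit as ε → 0 of the linear term of the regularized bound.
    refine ⟨(2 * traceCLM (X ^ (2 * k)) ^ (1 / k - 1 : ℝ)) •
      traceCLM.comp (ContinuousLinearMap.mul ℝ _ (X ^ (2 * k - 1))), fun Z hZ => ?_⟩
    simp only [smul_apply, ContinuousLinearMap.comp_apply,
      ContinuousLinearMap.mul_apply', smul_eq_mul]
    have hlim : ∀ Y : E →L[ℝ] E, Filter.Tendsto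
        (fun ε : ℝ => (traceCLM (Y ^ (2 * k)) + ε) ^ (1 / k : ℝ)) (nhdsWithin 0 (Set.Ioi 0))
        (nhds (schattenSq k Y)) := fun Y => by
      have : Continuous fun ε : ℝ => (traceCLM (Y ^ (2 * k)) + ε) ^ (1 / k : ℝ) :=
        (continuous_const.add continuous_id).rpow_const fun _ => Or.inr (by positivity)
      simpa [schattenSq] using (this.tendsto 0).mono_left nhdsWithin_le_nhds
    have hlim2 : Filter.Tendsto
        (fun ε : ℝ => 2 * (traceCLM (X ^ (2 * k)) + ε) ^ (1 / k - 1 : ℝ)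
          * traceCLM (X ^ (2 * k - 1) * Z)) (nhdsWithin 0 (Set.Ioi 0))
        (nhds (2 * traceCLM (X ^ (2 * k)) ^ (1 / k - 1 : ℝ)
          * traceCLM (X ^ (2 * k - 1) * Z))) := by
      by_cases h : traceCLM (X ^ (2 * k)) = 0
      · simp [traceCLM_pow_mul_eq_zero hX hk h]
      · have : ContinuousAt (fun ε : ℝ => (traceCLM (X ^ (2 * k)) + ε) ^ (1 / k - 1 : ℝ)) 0 :=
          (continuousAt_const.add continuousAt_id).rpow_const (Or.inl (by simpa using h))
        have := (this.tendsto.mono_left (nhdsWithin_le_nhds (s := Set.Ioi (0 : ℝ))))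
        simp only [add_zero] at this
        exact (this.const_mul 2).mul_const _
    exact le_of_tendsto_of_tendsto (hlim (X + Z))
      (((hlim X).add hlim2).add tendsto_const_nhds)
      (eventually_nhdsWithin_of_forall fun ε hε => rpow_traceCLM_add_le hX hZ hk hε)

lemma exists_isSmoothSqNorm (hE : 1 ≤ Module.finrank ℝ E) :
    ∃ (ψ : (E →L[ℝ] E) → ℝ) (K : ℝ), IsSmoothSqNorm ψ K ∧
      K ≤ 15 * (1 + Real.log (Module.finrank ℝ E)) := by
  have hd : (1 : ℝ) ≤ Module.finrank ℝ E := by exact_mod_cast hE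
  have hlog : 0 ≤ Real.log (Module.finrank ℝ E) := Real.log_nonneg hd
  -- With k ≥ log d the factor d^{1/k} is at most e < 3, while 2k - 1 stays of order 1 + log d.
  set k := ⌈Real.log (Module.finrank ℝ E)⌉₊ + 2 with hk
  refine ⟨schattenSq k, _, isSmoothSqNorm_schattenSq hE (by omega : 2 ≤ k), ?_⟩
  have h1 : (k : ℝ) ≤ Real.log (Module.finrank ℝ E) + 3 := by
    have := (Nat.ceil_lt_add_one hlog).le
    rw [hk]; push_cast; linarith
  have h2 : Real.log (Module.finrank ℝ E) ≤ k := by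
    have := Nat.le_ceil (Real.log (Module.finrank ℝ E))
    rw [hk]; push_cast; linarith
  have hk0 : (0 : ℝ) < k := by positivity
  have h3 : (Module.finrank ℝ E : ℝ) ^ (1 / k : ℝ) ≤ 3 := by
    rw [Real.rpow_def_of_pos (by linarith)]
    refine (Real.exp_le_exp.2 ?_).trans (Real.exp_one_lt_d9.le.trans (by norm_num))
    rw [mul_one_div, div_le_one hk0]
    exact h2
  have h4 : (2 * k - 1 : ℝ) ≤ 5 * (1 + Real.log (Module.finrank ℝ E)) := by linarith
  calc _ ≤ 5 * (1 + Real.log (Module.finrank ℝ E)) * 3 := by gcongr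
    _ = _ := by ring

end SchattenSmooth

/-! ### Joint measurability of stochastic gradients and Hessians. -/

section JointMeasurability

variable {E : Type*} [NormedAddCommGroup E] [InnerProductSpace ℝ E]
  [MeasurableSpace E] [BorelSpace E] {Ξ : Type*} [MeasurableSpace Ξ]

/-- A directional derivative is the pointwise limit of difference quotients with steps 1/n, each
jointly measurable. -/
lemma measurable_fderiv_apply_family [SecondCountableTopology E]
    {V : Type*} [NormedAddCommGroup V] [NormedSpace ℝ V]
    [MeasurableSpace V] [BorelSpace V] [SecondCountableTopology V] {G : Ξ → E → V}
    (hG : Measurable fun p : Ξ × E => G p.1 p.2) (hd : ∀ s, Differentiable ℝ (G s)) (w : E) :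
    Measurable fun p : Ξ × E => fderiv ℝ (G p.1) p.2 w := by
  refine measurable_of_tendsto_metrizable
    (f := fun (n : ℕ) p => (n : ℝ) • (G p.1 (p.2 + (n : ℝ)⁻¹ • w) - G p.1 p.2)) (fun n => ?_) ?_
  · have h1 : Measurable fun p : Ξ × E => (p.1, p.2 + (n : ℝ)⁻¹ • w) :=
      measurable_fst.prodMk (measurable_snd.add_const _)
    exact ((hG.comp h1).sub hG).const_smul _
  · rw [tendsto_pi_nhds]
    intro p
    refine (hd p.1 p.2).hasFDerivAt.lim w (c := fun n : ℕ => (n : ℝ)) ?_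
    simpa using tendsto_natCast_atTop_atTop

variable [FiniteDimensional ℝ E] {F : Ξ → E → ℝ}

lemma IsStochasticFamily.measurable_gradient (hF : IsStochasticFamily F) :
    Measurable fun p : Ξ × E => gradient (F p.1) p.2 := by
  have h0 : Measurable fun p : Ξ × E => F p.1 p.2 :=
    (measurable_uncurry_of_continuous_of_measurable (u := fun x s => F s x)
      (fun s => (hF.twice_diff s).1.continuous) hF.measurable).comp measurable_swap
  have h1 := measurable_fderiv_apply_family h0 fun s => (hF.twice_diff s).1
  have e : ∀ p : Ξ × E, gradient (F p.1) p.2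
      = ∑ i, fderiv ℝ (F p.1) p.2 (stdOrthonormalBasis ℝ E i) • stdOrthonormalBasis ℝ E i := by
    intro p
    conv_lhs => rw [← (stdOrthonormalBasis ℝ E).sum_repr' (gradient (F p.1) p.2)]
    refine Finset.sum_congr rfl fun i _ => ?_
    rw [real_inner_comm, inner_gradient_left]
  simp only [e]
  exact Finset.measurable_sum _ fun i _ => (h1 _).smul_const _

lemma IsStochasticFamily.measurable_hessian (hF : IsStochasticFamily F) :
    Measurable fun p : Ξ × E => hessian (F p.1) p.2 := by
  have h1 := measurable_fderiv_apply_family hF.measurable_gradient fun s => (hF.twice_diff s).2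
  have e : ∀ p : Ξ × E, hessian (F p.1) p.2
      = ∑ i, ContinuousLinearMap.smulRightL ℝ E E (innerSL ℝ (stdOrthonormalBasis ℝ E i))
        (hessian (F p.1) p.2 (stdOrthonormalBasis ℝ E i)) := by
    intro p
    ext v
    conv_lhs => rw [← (stdOrthonormalBasis ℝ E).sum_repr' v]
    simp
  rw [funext e]
  exact Finset.measurable_sum _ fun i _ =>
    (ContinuousLinearMap.continuous _).measurable.comp (h1 _)

end JointMeasurability

/-! ### Moments after adding one independent centred noise. -/

section Smooth

variable {E : Type*} [NormedAddCommGroup E] [InnerProductSpace ℝ E]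

/-- The smoothness bound along sZ is a quadratic in s that dominates ψ(X + sZ) ≥ 0, so its
discriminant is nonpositive; this bounds the linear term. -/
lemma IsSmoothSqNorm.exists_smooth {ψ : (E →L[ℝ] E) → ℝ} {K : ℝ} (h : IsSmoothSqNorm ψ K)
    {X : E →L[ℝ] E} (hX : (X : E →ₗ[ℝ] E).IsSymmetric) : ∃ ℓ : (E →L[ℝ] E) →L[ℝ] ℝ,
    ∀ Z : E →L[ℝ] E, (Z : E →ₗ[ℝ] E).IsSymmetric → ψ (X + Z) ≤ ψ X + ℓ Z + K * ‖Z‖ ^ 2 ∧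
      ℓ Z ^ 2 ≤ 4 * K * ψ X * ‖Z‖ ^ 2 := by
  obtain ⟨ℓ, hℓ⟩ := h.smooth X hX
  refine ⟨ℓ, fun Z hZ => ⟨hℓ Z hZ, ?_⟩⟩
  have := discrim_le_zero (a := K * ‖Z‖ ^ 2) (b := ℓ Z) (c := ψ X) fun s => by
    have h1 := hℓ (s • Z) (hZ.smul (by simp))
    have h2 := h.nonneg (isSymmetric_line hX hZ s)
    rw [norm_smul, map_smul, mul_pow, Real.norm_eq_abs, sq_abs, smul_eq_mul] at h1
    have h3 := h2.trans h1
    linarith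
  unfold discrim at this
  linarith

end Smooth

section OneStep

variable {Ω : Type*} {mΩ : MeasurableSpace Ω} {P : Measure Ω} [IsProbabilityMeasure P]

/-- If `ξ` is independent of `Y`, then a bound on `∫ G(y, ξ)` for fixed values `y = Y ω`
integrates to a bound on `∫ G(Y, ξ)`. -/
lemma integral_comp_le_of_indepFun {S Ξ : Type*} [MeasurableSpace S] [MeasurableSpace Ξ]
    {Y : Ω → S} {ξ : Ω → Ξ} (hY : Measurable Y) (hξ : Measurable ξ) (hind : IndepFun Y ξ P)
    {G : S × Ξ → ℝ} (hG : Measurable G) (hG0 : ∀ p, 0 ≤ G p) {B : Ω → ℝ} (hB : Integrable B P)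
    (h1 : ∀ ω, Integrable (fun ω' => G (Y ω, ξ ω')) P)
    (h2 : ∀ ω, ∫ ω', G (Y ω, ξ ω') ∂P ≤ B ω) :
    Integrable (fun ω => G (Y ω, ξ ω)) P ∧ ∫ ω, G (Y ω, ξ ω) ∂P ≤ ∫ ω, B ω ∂P := by
  have hB0 : ∀ ω, 0 ≤ B ω := fun ω => (integral_nonneg fun _ => hG0 _).trans (h2 ω)
  -- Lower integrals allow Tonelli's theorem before integrability is known; integrability is then a
  -- consequence of the bound.
  have hle : ∫⁻ ω, ENNReal.ofReal (G (Y ω, ξ ω)) ∂P ≤ ∫⁻ ω, ENNReal.ofReal (B ω) ∂P := by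
    have hmap := (indepFun_iff_map_prod_eq_prod_map_map hY.aemeasurable hξ.aemeasurable).1 hind
    have hG' : Measurable fun p => ENNReal.ofReal (G p) := hG.ennreal_ofReal
    have := Measure.isProbabilityMeasure_map (μ := P) hξ.aemeasurable
    calc ∫⁻ ω, ENNReal.ofReal (G (Y ω, ξ ω)) ∂P
        = ∫⁻ p, ENNReal.ofReal (G p) ∂(P.map fun ω => (Y ω, ξ ω)) :=
          (lintegral_map hG' (hY.prodMk hξ)).symm
      _ = ∫⁻ y, ∫⁻ s, ENNReal.ofReal (G (y, s)) ∂(P.map ξ) ∂(P.map Y) := by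
          rw [hmap, lintegral_prod _ hG'.aemeasurable]
      _ = ∫⁻ ω, ∫⁻ s, ENNReal.ofReal (G (Y ω, s)) ∂(P.map ξ) ∂P :=
          lintegral_map hG'.lintegral_prod_right' hY
      _ ≤ ∫⁻ ω, ENNReal.ofReal (B ω) ∂P := by
          refine lintegral_mono fun ω => ?_
          rw [lintegral_map (f := fun s => ENNReal.ofReal (G (Y ω, s)))
              (hG'.comp measurable_prodMk_left) hξ,
            ← ofReal_integral_eq_lintegral_ofReal (h1 ω) (ae_of_all _ fun _ => hG0 _)]
          exact ENNReal.ofReal_le_ofReal (h2 ω)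
  have hm : Measurable fun ω => G (Y ω, ξ ω) := hG.comp (hY.prodMk hξ)
  have hBfin : ∫⁻ ω, ENNReal.ofReal (B ω) ∂P < ⊤ :=
    (hasFiniteIntegral_iff_ofReal (ae_of_all _ hB0)).1 hB.2
  have hint : Integrable (fun ω => G (Y ω, ξ ω)) P :=
    ⟨hm.aestronglyMeasurable, (hasFiniteIntegral_iff_ofReal (ae_of_all _ fun _ => hG0 _)).2
      (hle.trans_lt hBfin)⟩
  refine ⟨hint, ?_⟩
  rw [integral_eq_lintegral_of_nonneg_ae (ae_of_all _ fun _ => hG0 _) hm.aestronglyMeasurable,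
    integral_eq_lintegral_of_nonneg_ae (ae_of_all _ hB0) hB.1]
  exact ENNReal.toReal_mono hBfin.ne hle

variable {E : Type*} [NormedAddCommGroup E] [InnerProductSpace ℝ E] [CompleteSpace E]

lemma integral_norm_add_sq_le {Z : Ω → E} {σ : ℝ} (hZ : Integrable Z P)
    (h0 : ∫ ω, Z ω ∂P = 0)
    (h2 : Integrable (fun ω => ‖Z ω‖ ^ 2) P) (hσ : ∫ ω, ‖Z ω‖ ^ 2 ∂P ≤ σ ^ 2) (X : E) :
    Integrable (fun ω => ‖X + Z ω‖ ^ 2) P ∧ ∫ ω, ‖X + Z ω‖ ^ 2 ∂P ≤ ‖X‖ ^ 2 + σ ^ 2 := by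
  have hi : Integrable (fun ω => inner ℝ X (Z ω)) P := hZ.const_inner X
  have e : (fun ω => ‖X + Z ω‖ ^ 2) = fun ω => ‖X‖ ^ 2 + 2 * inner ℝ X (Z ω) + ‖Z ω‖ ^ 2 :=
    funext fun ω => norm_add_sq_real _ _
  have hi1 : Integrable (fun ω => ‖X‖ ^ 2 + 2 * inner ℝ X (Z ω)) P :=
    (integrable_const _).add (hi.const_mul 2)
  rw [e]
  refine ⟨hi1.add h2, ?_⟩
  rw [integral_add hi1 h2, integral_add (integrable_const _) (hi.const_mul 2),
    integral_const_mul, integral_inner hZ, h0]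
  simpa using hσ

/-- The linear term integrates to zero. When the bound is squared, ℓ² ≤ 4Kψ‖Z‖² raises the
coefficient 2 of Kψ‖Z‖² to 10, and the almost sure bound reduces ‖Z‖⁴ to δ²‖Z‖². -/
lemma IsSmoothSqNorm.integral_add_le {ψ : (E →L[ℝ] E) → ℝ} {K : ℝ} (h : IsSmoothSqNorm ψ K)
    {Z : Ω → E →L[ℝ] E} {σ δ : ℝ} (hs : ∀ ω, (Z ω : E →ₗ[ℝ] E).IsSymmetric)
    (hZ : Integrable Z P) (h0 : ∫ ω, Z ω ∂P = 0)
    (h2 : Integrable (fun ω => ‖Z ω‖ ^ 2) P) (hσ : ∫ ω, ‖Z ω‖ ^ 2 ∂P ≤ σ ^ 2)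
    (hδ : ∀ᵐ ω ∂P, ‖Z ω‖ ≤ δ) {X : E →L[ℝ] E} (hX : (X : E →ₗ[ℝ] E).IsSymmetric) :
    (Integrable (fun ω => ψ (X + Z ω)) P ∧ ∫ ω, ψ (X + Z ω) ∂P ≤ ψ X + K * σ ^ 2) ∧
    (Integrable (fun ω => ψ (X + Z ω) ^ 2) P ∧
      ∫ ω, ψ (X + Z ω) ^ 2 ∂P ≤ ψ X ^ 2 + 10 * K * ψ X * σ ^ 2 + 2 * K ^ 2 * δ ^ 2 * σ ^ 2) := by
  obtain ⟨ℓ, hℓ⟩ := h.exists_smooth hX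
  have hK := h.pos
  have hX0 := h.nonneg hX
  have hn : ∀ ω, 0 ≤ ψ (X + Z ω) := fun ω => h.nonneg (hX.add (hs ω))
  have hm : AEStronglyMeasurable (fun ω => ψ (X + Z ω)) P :=
    h.continuous.comp_aestronglyMeasurable (hZ.1.const_add X)
  have hℓi : Integrable (fun ω => ℓ (Z ω)) P := ℓ.integrable_comp hZ
  have hℓ0 : ∫ ω, ℓ (Z ω) ∂P = 0 := by rw [ℓ.integral_comp_comm hZ, h0, map_zero]
  have hc1 : Integrable (fun ω => ψ X + ℓ (Z ω)) P := (integrable_const _).add hℓi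
  have hc2 : Integrable (fun ω => ψ X ^ 2 + 2 * ψ X * ℓ (Z ω)) P :=
    (integrable_const _).add (hℓi.const_mul _)
  have hb1 : Integrable (fun ω => ψ X + ℓ (Z ω) + K * ‖Z ω‖ ^ 2) P :=
    hc1.add (h2.const_mul K)
  have hb2 : Integrable (fun ω => ψ X ^ 2 + 2 * ψ X * ℓ (Z ω)
      + (10 * K * ψ X + 2 * K ^ 2 * δ ^ 2) * ‖Z ω‖ ^ 2) P :=
    hc2.add (h2.const_mul _)
  have hle2 : ∀ᵐ ω ∂P, ψ (X + Z ω) ^ 2 ≤ ψ X ^ 2 + 2 * ψ X * ℓ (Z ω)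
      + (10 * K * ψ X + 2 * K ^ 2 * δ ^ 2) * ‖Z ω‖ ^ 2 := by
    filter_upwards [hδ] with ω hω
    obtain ⟨ha, hb⟩ := hℓ (Z ω) (hs ω)
    have hz : ‖Z ω‖ ^ 2 ≤ δ ^ 2 := by gcongr
    calc ψ (X + Z ω) ^ 2 ≤ (ψ X + ℓ (Z ω) + K * ‖Z ω‖ ^ 2) ^ 2 := by gcongr; exact hn ω
      _ ≤ ψ X ^ 2 + 2 * ψ X * ℓ (Z ω) + 2 * K * ψ X * ‖Z ω‖ ^ 2 + 2 * ℓ (Z ω) ^ 2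
          + 2 * K ^ 2 * (‖Z ω‖ ^ 2 * ‖Z ω‖ ^ 2) := by
        linarith [sq_nonneg (ℓ (Z ω) - K * ‖Z ω‖ ^ 2)]
      _ ≤ ψ X ^ 2 + 2 * ψ X * ℓ (Z ω) + 2 * K * ψ X * ‖Z ω‖ ^ 2 + 2 * (4 * K * ψ X * ‖Z ω‖ ^ 2)
          + 2 * K ^ 2 * (δ ^ 2 * ‖Z ω‖ ^ 2) := by gcongr
      _ = _ := by ring
  refine ⟨⟨hb1.mono' hm (ae_of_all _ fun ω => ?_), ?_⟩,
    hb2.mono' (hm.pow 2) ?_, ?_⟩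
  · rw [Real.norm_of_nonneg (hn ω)]; exact (hℓ _ (hs ω)).1
  · refine (integral_mono_of_nonneg (ae_of_all _ hn) hb1
      (ae_of_all _ fun ω => (hℓ _ (hs ω)).1)).trans ?_
    rw [integral_add hc1 (h2.const_mul K), integral_add (integrable_const _) hℓi,
      integral_const_mul, hℓ0]
    simp only [integral_const, probReal_univ, one_smul, add_zero]
    gcongr
  · filter_upwards [hle2] with ω hω
    rwa [Real.norm_of_nonneg (sq_nonneg _)]
  · refine (integral_mono_of_nonneg (ae_of_all _ fun ω => sq_nonneg _) hb2 hle2).trans ?_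
    rw [integral_add hc2 (h2.const_mul _), integral_add (integrable_const _) (hℓi.const_mul _),
      integral_const_mul, integral_const_mul, hℓ0]
    simp only [integral_const, probReal_univ, one_smul, mul_zero, add_zero]
    have : (10 * K * ψ X + 2 * K ^ 2 * δ ^ 2) * ∫ ω, ‖Z ω‖ ^ 2 ∂P
        ≤ (10 * K * ψ X + 2 * K ^ 2 * δ ^ 2) * σ ^ 2 := by gcongr
    linarith

end OneStep

/-! ### Moments of exponentially averaged noise. -/

section Averages

variable {Ω : Type*} {mΩ : MeasurableSpace Ω} {P : Measure Ω}

/-- Jensen's inequality for the convex power r; integrability follows from Y ≤ 1 + Y^r. -/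
lemma integral_le_of_integral_rpow_le [IsProbabilityMeasure P] {Y : Ω → ℝ} (hY : AEStronglyMeasurable Y P)
    (hY0 : ∀ ω, 0 ≤ Y ω) {r τ : ℝ} (hr : 1 ≤ r) (hτ : 0 ≤ τ)
    (hi : Integrable (fun ω => Y ω ^ r) P) (h : ∫ ω, Y ω ^ r ∂P ≤ τ ^ r) :
    Integrable Y P ∧ ∫ ω, Y ω ∂P ≤ τ := by
  have hint : Integrable Y P := by
    refine ((integrable_const (1 : ℝ)).add hi).mono' hY (ae_of_all _ fun ω => ?_)
    rw [Real.norm_of_nonneg (hY0 ω)]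
    have h0 := Real.rpow_nonneg (hY0 ω) r
    rcases le_total (Y ω) 1 with h1 | h1
    · exact h1.trans (by simpa using h0)
    · exact (Real.self_le_rpow_of_one_le h1 hr).trans (by simp)
  refine ⟨hint, ?_⟩
  have hj := (convexOn_rpow hr).map_integral_le (μ := P) (f := Y)
    (Real.continuous_rpow_const (by linarith)).continuousOn isClosed_Ici
    (ae_of_all _ hY0) hint hi
  exact (Real.rpow_le_rpow_iff (integral_nonneg hY0) hτ (by linarith)).1 (hj.trans h)

variable {E : Type*} [MeasurableSpace E] {Ξ : Type*} [MeasurableSpace Ξ]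
  {V : Type*} [NormedAddCommGroup V] [NormedSpace ℝ V] [MeasurableSpace V]
  {ℱ : Filtration ℕ mΩ} {T : ℕ} {γ : ℝ} {n : Ξ × E → V} {ξ : ℕ → Ω → Ξ} {y : ℕ → Ω → E}
  {N : ℕ → Ω → V}

/-- `N` is the exponential moving average, with weight `γ`, of the noises `n (ξ t, y t)`, where
the samples `ξ t` are independent of the past and `y t` depends on the past only. -/
structure IsNoiseAverage (P : Measure Ω) (ℱ : Filtration ℕ mΩ) (T : ℕ) (γ : ℝ) (n : Ξ × E → V)
    (ξ : ℕ → Ω → Ξ) (y : ℕ → Ω → E) (N : ℕ → Ω → V) : Prop where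
  measurable_noise : Measurable n
  measurable_sample : ∀ t < T, Measurable[ℱ (t + 1)] (ξ t)
  indep : ∀ t < T, Indep (MeasurableSpace.comap (ξ t) inferInstance) (ℱ t) P
  adapted : ∀ t < T, Measurable[ℱ t] (y t)
  zero : ∀ ω, N 0 ω = 0
  succ : ∀ t ω, N (t + 1) ω = (1 - γ) • N t ω + γ • n (ξ (t + 1) ω, y (t + 1) ω)

variable [BorelSpace V] [SecondCountableTopology V]

lemma IsNoiseAverage.measurable (h : IsNoiseAverage P ℱ T γ n ξ y N) (t : ℕ) (ht : t < T) :
    Measurable[ℱ (t + 1)] (N t) := by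
  induction t with
  | zero => rw [funext h.zero]; exact measurable_const
  | succ t ih =>
    rw [funext (h.succ t)]
    have h1 : Measurable[ℱ (t + 1 + 1)] (N t) :=
      (ih (by omega)).mono (ℱ.mono (by omega)) le_rfl
    have h2 : Measurable[ℱ (t + 1 + 1)] (y (t + 1)) :=
      (h.adapted _ ht).mono (ℱ.mono (by omega)) le_rfl
    have h3 := h.measurable_noise.comp ((h.measurable_sample _ ht).prodMk h2)
    exact (h1.const_smul (1 - γ)).add (h3.const_smul γ)

/-- The previous average and the new sampling point are both known at time t + 1, when the new
sample is still independent. Hence they may be frozen while the sample is integrated out. -/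
lemma IsNoiseAverage.integral_succ_le [IsProbabilityMeasure P] (h : IsNoiseAverage P ℱ T γ n ξ y N) {t : ℕ}
    (ht : t + 1 < T) {Φ : V → ℝ} (hΦ : Measurable Φ)
    (hΦ0 : ∀ v, 0 ≤ Φ v)
    {B : Ω → ℝ} (hB : Integrable B P)
    (hi : ∀ ω, Integrable (fun ω' => Φ ((1 - γ) • N t ω + γ • n (ξ (t + 1) ω', y (t + 1) ω))) P)
    (hle : ∀ ω, ∫ ω', Φ ((1 - γ) • N t ω + γ • n (ξ (t + 1) ω', y (t + 1) ω)) ∂P ≤ B ω) :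
    Integrable (fun ω => Φ (N (t + 1) ω)) P ∧ ∫ ω, Φ (N (t + 1) ω) ∂P ≤ ∫ ω, B ω ∂P := by
  have hY : Measurable[ℱ (t + 1)] fun ω => (N t ω, y (t + 1) ω) :=
    (h.measurable t (by omega)).prodMk (h.adapted _ ht)
  have hind : IndepFun (fun ω => (N t ω, y (t + 1) ω)) (ξ (t + 1)) P := by
    rw [IndepFun_iff_Indep]
    exact indep_of_indep_of_le_left (h.indep _ ht).symm hY.comap_le
  have hG : Measurable fun p : (V × E) × Ξ => Φ ((1 - γ) • p.1.1 + γ • n (p.2, p.1.2)) :=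
    hΦ.comp ((measurable_fst.fst.const_smul _).add
      ((h.measurable_noise.comp (measurable_snd.prodMk measurable_fst.snd)).const_smul _))
  simp only [h.succ]
  exact integral_comp_le_of_indepFun (hY.mono (ℱ.le _) le_rfl)
    ((h.measurable_sample _ ht).mono (ℱ.le _) le_rfl) hind hG (fun _ => hΦ0 _) hB hi hle

lemma IsNoiseAverage.aestronglyMeasurable (h : IsNoiseAverage P ℱ T γ n ξ y N) {t : ℕ} (ht : t < T) :
    AEStronglyMeasurable (N t) P :=
  ((h.measurable t ht).mono (ℱ.le _) le_rfl).aestronglyMeasurable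

end Averages

section GradientAverage

variable {Ω : Type*} {mΩ : MeasurableSpace Ω} {P : Measure Ω} [IsProbabilityMeasure P]
  {E : Type*} [MeasurableSpace E] {Ξ : Type*} [MeasurableSpace Ξ]
  {V : Type*} [NormedAddCommGroup V] [InnerProductSpace ℝ V] [CompleteSpace V] [MeasurableSpace V]
  [BorelSpace V] [SecondCountableTopology V]
  {ℱ : Filtration ℕ mΩ} {T : ℕ} {γ σ : ℝ} {n : Ξ × E → V} {ξ : ℕ → Ω → Ξ} {y : ℕ → Ω → E}
  {N : ℕ → Ω → V}

lemma IsNoiseAverage.integral_norm_sq_le (h : IsNoiseAverage P ℱ T γ n ξ y N)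
    (hγ : γ ∈ Set.Ioc (0 : ℝ) 1)
    (hn : ∀ t, 1 ≤ t → t < T → ∀ z, Integrable (fun ω => n (ξ t ω, z)) P ∧
      ∫ ω, n (ξ t ω, z) ∂P = 0 ∧ Integrable (fun ω => ‖n (ξ t ω, z)‖ ^ 2) P ∧
      ∫ ω, ‖n (ξ t ω, z)‖ ^ 2 ∂P ≤ σ ^ 2) (t : ℕ) (ht : t < T) :
    Integrable (fun ω => ‖N t ω‖ ^ 2) P ∧ ∫ ω, ‖N t ω‖ ^ 2 ∂P ≤ γ * σ ^ 2 := by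
  obtain ⟨hγ0, hγ1⟩ := hγ
  induction t with
  | zero => simpa [h.zero] using by positivity
  | succ t ih =>
    obtain ⟨hi, hle⟩ := ih (by omega)
    have key : ∀ ω, Integrable (fun ω' =>
        ‖(1 - γ) • N t ω + γ • n (ξ (t + 1) ω', y (t + 1) ω)‖ ^ 2) P ∧
        ∫ ω', ‖(1 - γ) • N t ω + γ • n (ξ (t + 1) ω', y (t + 1) ω)‖ ^ 2 ∂P
          ≤ (1 - γ) ^ 2 * ‖N t ω‖ ^ 2 + γ ^ 2 * σ ^ 2 := fun ω => by
      obtain ⟨h1, h2, h3, h4⟩ := hn (t + 1) (by omega) ht (y (t + 1) ω)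
      have e : ∀ ω', ‖γ • n (ξ (t + 1) ω', y (t + 1) ω)‖ ^ 2
          = γ ^ 2 * ‖n (ξ (t + 1) ω', y (t + 1) ω)‖ ^ 2 := fun ω' => by
        rw [norm_smul, mul_pow, Real.norm_of_nonneg hγ0.le]
      have := integral_norm_add_sq_le (P := P) (σ := γ * σ) (h1.smul γ)
        (by simp only [Pi.smul_apply]; rw [integral_smul, h2, smul_zero])
        (by simp only [Pi.smul_apply, e]; exact h3.const_mul _)
        (by simp only [Pi.smul_apply, e]; rw [integral_const_mul, mul_pow]; gcongr)
        ((1 - γ) • N t ω)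
      rw [norm_smul, mul_pow, mul_pow, Real.norm_of_nonneg (sub_nonneg.2 hγ1)] at this
      exact this
    have hB : Integrable (fun ω => (1 - γ) ^ 2 * ‖N t ω‖ ^ 2 + γ ^ 2 * σ ^ 2) P :=
      (hi.const_mul _).add (integrable_const _)
    obtain ⟨h1, h2⟩ := h.integral_succ_le ht (Φ := fun v => ‖v‖ ^ 2) (by fun_prop)
      (fun v => sq_nonneg _) hB (fun ω => (key ω).1) (fun ω => (key ω).2)
    refine ⟨h1, h2.trans ?_⟩
    rw [integral_add (hi.const_mul _) (integrable_const _), integral_const_mul]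
    simp only [integral_const, probReal_univ, one_smul]
    have : (1 - γ) ^ 2 * ∫ ω, ‖N t ω‖ ^ 2 ∂P ≤ (1 - γ) ^ 2 * (γ * σ ^ 2) := by gcongr
    -- The bound γσ² is preserved because (1-γ)²γ + γ² ≤ γ; the difference is γ²(1-γ).
    have : 0 ≤ γ * (γ * (1 - γ)) * σ ^ 2 := by
      have := sub_nonneg.2 hγ1; positivity
    linarith

end GradientAverage

section Symmetric

variable {Ω : Type*} {mΩ : MeasurableSpace Ω} {P : Measure Ω}
  {E : Type*} [NormedAddCommGroup E] [InnerProductSpace ℝ E]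
  {D : Type*} [MeasurableSpace D] {Ξ : Type*} [MeasurableSpace Ξ]
  {ℱ : Filtration ℕ mΩ} {T : ℕ} {γ : ℝ} {n : Ξ × D → E →L[ℝ] E} {ξ : ℕ → Ω → Ξ}
  {y : ℕ → Ω → D} {N : ℕ → Ω → E →L[ℝ] E}

lemma IsNoiseAverage.isSymmetric (h : IsNoiseAverage P ℱ T γ n ξ y N)
    (hs : ∀ p, (n p : E →ₗ[ℝ] E).IsSymmetric) (t : ℕ) (ω : Ω) :
    (N t ω : E →ₗ[ℝ] E).IsSymmetric := by
  induction t with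
  | zero => rw [h.zero]; exact LinearMap.IsSymmetric.zero
  | succ t ih =>
    rw [h.succ]
    exact isSymmetric_line (ih.smul (by simp)) (hs _) γ

end Symmetric

section HessianAverage

variable {Ω : Type*} {mΩ : MeasurableSpace Ω} {P : Measure Ω} [IsProbabilityMeasure P]
  {E : Type*} [NormedAddCommGroup E] [InnerProductSpace ℝ E] [FiniteDimensional ℝ E]
  {D : Type*} [MeasurableSpace D] {Ξ : Type*} [MeasurableSpace Ξ]
  {ℱ : Filtration ℕ mΩ} {T : ℕ} {γ σ δ : ℝ} {n : Ξ × D → E →L[ℝ] E} {ξ : ℕ → Ω → Ξ}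
  {y : ℕ → Ω → D} {N : ℕ → Ω → E →L[ℝ] E}

lemma IsNoiseAverage.integral_smoothSqNorm_le (h : IsNoiseAverage P ℱ T γ n ξ y N)
    (hs : ∀ p, (n p : E →ₗ[ℝ] E).IsSymmetric) (hγ : γ ∈ Set.Ioc (0 : ℝ) 1)
    {ψ : (E →L[ℝ] E) → ℝ} {K : ℝ} (hψ : IsSmoothSqNorm ψ K)
    (hn : ∀ t, 1 ≤ t → t < T → ∀ z, Integrable (fun ω => n (ξ t ω, z)) P ∧
      ∫ ω, n (ξ t ω, z) ∂P = 0 ∧ Integrable (fun ω => ‖n (ξ t ω, z)‖ ^ 2) P ∧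
      ∫ ω, ‖n (ξ t ω, z)‖ ^ 2 ∂P ≤ σ ^ 2 ∧ ∀ᵐ ω ∂P, ‖n (ξ t ω, z)‖ ≤ δ) (t : ℕ) (ht : t < T) :
    (Integrable (fun ω => |ψ (N t ω)|) P ∧ ∫ ω, |ψ (N t ω)| ∂P ≤ γ * (K * σ ^ 2)) ∧
    (Integrable (fun ω => ψ (N t ω) ^ 2) P ∧
      ∫ ω, ψ (N t ω) ^ 2 ∂P ≤ K ^ 2 * (10 * γ ^ 2 * σ ^ 4 + 2 * γ ^ 3 * δ ^ 2 * σ ^ 2)) := by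
  obtain ⟨hγ0, hγ1⟩ := hγ
  have hγ1' := sub_nonneg.2 hγ1
  have hK := hψ.pos
  induction t with
  | zero =>
    have : ψ 0 = 0 := by simpa using hψ.smul 0 LinearMap.IsSymmetric.zero 0 le_rfl
    simp only [h.zero, this]
    simpa using ⟨by positivity, by positivity⟩
  | succ t ih =>
    obtain ⟨⟨hi1, hle1⟩, hi2, hle2⟩ := ih (by omega)
    have hsN := h.isSymmetric hs t
    -- Absolute values appear because ψ is known to be nonnegative only on symmetric operators,
    -- while the conditioning lemma asks for it everywhere.
    have key : ∀ ω,
        (Integrable (fun ω' => |ψ ((1 - γ) • N t ω + γ • n (ξ (t + 1) ω', y (t + 1) ω))|) P ∧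
        ∫ ω', |ψ ((1 - γ) • N t ω + γ • n (ξ (t + 1) ω', y (t + 1) ω))| ∂P
          ≤ (1 - γ) ^ 2 * |ψ (N t ω)| + K * (γ * σ) ^ 2) ∧
        (Integrable (fun ω' => ψ ((1 - γ) • N t ω + γ • n (ξ (t + 1) ω', y (t + 1) ω)) ^ 2) P ∧
        ∫ ω', ψ ((1 - γ) • N t ω + γ • n (ξ (t + 1) ω', y (t + 1) ω)) ^ 2 ∂P
          ≤ (1 - γ) ^ 4 * ψ (N t ω) ^ 2 + 10 * K * (1 - γ) ^ 2 * (γ * σ) ^ 2 * |ψ (N t ω)|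
            + 2 * K ^ 2 * (γ * δ) ^ 2 * (γ * σ) ^ 2) := fun ω => by
      obtain ⟨h1, h2, h3, h4, h5⟩ := hn (t + 1) (by omega) ht (y (t + 1) ω)
      have e : ∀ ω', ‖γ • n (ξ (t + 1) ω', y (t + 1) ω)‖ ^ 2
          = γ ^ 2 * ‖n (ξ (t + 1) ω', y (t + 1) ω)‖ ^ 2 := fun ω' => by
        rw [norm_smul, mul_pow, Real.norm_of_nonneg hγ0.le]
      have hsl : ∀ ω', ((γ • n (ξ (t + 1) ω', y (t + 1) ω) : E →L[ℝ] E) : E →ₗ[ℝ] E).IsSymmetric :=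
        fun ω' => (hs _).smul (by simp)
      have hsX : (((1 - γ) • N t ω : E →L[ℝ] E) : E →ₗ[ℝ] E).IsSymmetric := (hsN ω).smul (by simp)
      have := hψ.integral_add_le (P := P) (σ := γ * σ) (δ := γ * δ) hsl (h1.smul γ)
        ((integral_smul γ _).trans (by rw [h2, smul_zero]))
        (by simp only [e]; exact h3.const_mul _)
        (by simp only [e]; rw [integral_const_mul, mul_pow]; gcongr)
        (by
          filter_upwards [h5] with ω' h'
          rw [norm_smul, Real.norm_of_nonneg hγ0.le]; gcongr)
        hsX
      have ea : ∀ ω', |ψ ((1 - γ) • N t ω + γ • n (ξ (t + 1) ω', y (t + 1) ω))|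
          = ψ ((1 - γ) • N t ω + γ • n (ξ (t + 1) ω', y (t + 1) ω)) := fun ω' =>
        abs_of_nonneg (hψ.nonneg (hsX.add (hsl ω')))
      rw [hψ.smul _ (hsN ω) _ hγ1'] at this
      simp only [ea]
      rw [abs_of_nonneg (hψ.nonneg (hsN ω))]
      refine ⟨this.1, this.2.1, this.2.2.trans (le_of_eq (by ring))⟩
    have hB1 : Integrable (fun ω => (1 - γ) ^ 2 * |ψ (N t ω)| + K * (γ * σ) ^ 2) P :=
      (hi1.const_mul _).add (integrable_const _)
    have hB2' : Integrable (fun ω => (1 - γ) ^ 4 * ψ (N t ω) ^ 2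
        + 10 * K * (1 - γ) ^ 2 * (γ * σ) ^ 2 * |ψ (N t ω)|) P :=
      (hi2.const_mul _).add (hi1.const_mul _)
    have hB2 : Integrable (fun ω => (1 - γ) ^ 4 * ψ (N t ω) ^ 2
        + 10 * K * (1 - γ) ^ 2 * (γ * σ) ^ 2 * |ψ (N t ω)|
            + 2 * K ^ 2 * (γ * δ) ^ 2 * (γ * σ) ^ 2) P := hB2'.add (integrable_const _)
    obtain ⟨a1, a2⟩ := h.integral_succ_le ht (Φ := fun v => |ψ v|)
      hψ.continuous.abs.measurable (fun v => abs_nonneg _) hB1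
      (fun ω => (key ω).1.1) (fun ω => (key ω).1.2)
    obtain ⟨b1, b2⟩ := h.integral_succ_le ht (Φ := fun v => ψ v ^ 2)
      (hψ.continuous.pow 2).measurable (fun v => sq_nonneg _) hB2
      (fun ω => (key ω).2.1) (fun ω => (key ω).2.2)
    refine ⟨⟨a1, a2.trans ?_⟩, b1, b2.trans ?_⟩
    · rw [integral_add (hi1.const_mul _) (integrable_const _), integral_const_mul]
      simp only [integral_const, probReal_univ, one_smul]
      have : (1 - γ) ^ 2 * ∫ ω, |ψ (N t ω)| ∂P ≤ (1 - γ) ^ 2 * (γ * (K * σ ^ 2)) := by gcongr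
      have : 0 ≤ γ * (γ * (1 - γ)) * (K * σ ^ 2) := by positivity
      linarith
    · rw [integral_add hB2' (integrable_const _), integral_add (hi2.const_mul _) (hi1.const_mul _),
        integral_const_mul, integral_const_mul]
      simp only [integral_const, probReal_univ, one_smul]
      -- A is the fixed point of the recursion v ↦ (1-γ)v + c, where c collects the noise terms
      -- after inserting the first-moment bound.
      set A := K ^ 2 * (10 * γ ^ 2 * σ ^ 4 + 2 * γ ^ 3 * δ ^ 2 * σ ^ 2) with hA
      have hA0 : 0 ≤ A := by positivity
      have c1 : (1 - γ) ^ 4 * ∫ ω, ψ (N t ω) ^ 2 ∂P ≤ (1 - γ) * A := by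
        have : (1 - γ) ^ 4 ≤ 1 - γ := pow_le_of_le_one hγ1' (by linarith) (by norm_num)
        calc _ ≤ (1 - γ) ^ 4 * A := by gcongr
          _ ≤ _ := by gcongr
      have c2 : 10 * K * (1 - γ) ^ 2 * (γ * σ) ^ 2 * ∫ ω, |ψ (N t ω)| ∂P
          ≤ 10 * K * 1 * (γ * σ) ^ 2 * (γ * (K * σ ^ 2)) := by
        have : (1 - γ) ^ 2 ≤ 1 := pow_le_one₀ hγ1' (by linarith)
        gcongr
      have c3 : γ * A = 10 * K * 1 * (γ * σ) ^ 2 * (γ * (K * σ ^ 2))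
          + 2 * K ^ 2 * (γ * δ) ^ 2 * (γ * σ) ^ 2 := by rw [hA]; ring
      linarith

lemma IsNoiseAverage.integral_norm_pow_three_le (h : IsNoiseAverage P ℱ T γ n ξ y N)
    (hs : ∀ p, (n p : E →ₗ[ℝ] E).IsSymmetric) (hγ : γ ∈ Set.Ioc (0 : ℝ) 1)
    (hE : 1 ≤ Module.finrank ℝ E) (hσ : 0 ≤ σ) (hδ : 0 ≤ δ)
    (hn : ∀ t, 1 ≤ t → t < T → ∀ z, Integrable (fun ω => n (ξ t ω, z)) P ∧
      ∫ ω, n (ξ t ω, z) ∂P = 0 ∧ Integrable (fun ω => ‖n (ξ t ω, z)‖ ^ 2) P ∧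
      ∫ ω, ‖n (ξ t ω, z)‖ ^ 2 ∂P ≤ σ ^ 2 ∧ ∀ᵐ ω ∂P, ‖n (ξ t ω, z)‖ ≤ δ) {t : ℕ} (ht : t < T) :
    Integrable (fun ω => ‖N t ω‖ ^ 3) P ∧ ∫ ω, ‖N t ω‖ ^ 3 ∂P
      ≤ 2000 * (γ ^ (3 / 2 : ℝ) * effHessNoiseCube (Module.finrank ℝ E) γ σ δ) := by
  obtain ⟨ψ, K, hψ, hKd⟩ := exists_isSmoothSqNorm (E := E) hE
  obtain ⟨-, hi, hle⟩ := h.integral_smoothSqNorm_le hs hγ hψ hn t ht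
  have hK := hψ.pos
  have hγ0 := hγ.1
  have hm := h.aestronglyMeasurable ht
  have hp : ∀ ω, ‖N t ω‖ ^ 4 ≤ ψ (N t ω) ^ 2 := fun ω => by
    have := hψ.sq_norm_le _ (h.isSymmetric hs t ω)
    calc ‖N t ω‖ ^ 4 = (‖N t ω‖ ^ 2) ^ 2 := by ring
      _ ≤ _ := by gcongr
  have h4 : Integrable (fun ω => ‖N t ω‖ ^ 4) P :=
    hi.mono' (hm.norm.pow 4) (ae_of_all _ fun ω => by
      rw [Real.norm_of_nonneg (by positivity)]; exact hp ω)
  set u := √(K * γ) with hu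
  have hu2 : u ^ 2 = K * γ := Real.sq_sqrt (by positivity)
  -- τ is chosen with τ⁴ above the fourth-moment bound, so Jensen with exponent 4/3 bounds the third
  -- moment by τ³.
  set τ := 2 * u * (σ + √γ * δ) with hτ
  have hτ0 : 0 ≤ τ := by positivity
  have h4' : ∫ ω, ‖N t ω‖ ^ 4 ∂P ≤ τ ^ 4 := by
    refine (integral_mono h4 hi hp).trans (hle.trans ?_)
    have e : τ ^ 4 = 16 * (K * γ) ^ 2 * (σ + √γ * δ) ^ 4 := by rw [hτ, ← hu2]; ring
    have e2 : K ^ 2 * (10 * γ ^ 2 * σ ^ 4 + 2 * γ ^ 3 * δ ^ 2 * σ ^ 2)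
        = (K * γ) ^ 2 * (10 * σ ^ 4 + 2 * (√γ ^ 2) * δ ^ 2 * σ ^ 2) := by
      rw [Real.sq_sqrt hγ0.le]; ring
    rw [e, e2, mul_comm 16, mul_assoc ((K * γ) ^ 2)]
    have hw : 0 ≤ √γ * δ := by positivity
    refine mul_le_mul_of_nonneg_left ?_ (by positivity)
    have : 0 ≤ σ ^ 3 * (√γ * δ) := by positivity
    have : 0 ≤ σ * (√γ * δ) ^ 3 := by positivity
    have : 0 ≤ (√γ * δ) ^ 4 := by positivity
    have : 0 ≤ σ ^ 4 := by positivity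
    have : 0 ≤ σ ^ 2 * (√γ * δ) ^ 2 := by positivity
    linarith
  have e4 : ∀ ω, (‖N t ω‖ ^ 3) ^ (4 / 3 : ℝ) = ‖N t ω‖ ^ 4 := fun ω => by
    rw [← Real.rpow_natCast, ← Real.rpow_mul (norm_nonneg _), ← Real.rpow_natCast]; norm_num
  have e4' : (τ ^ 3) ^ (4 / 3 : ℝ) = τ ^ 4 := by
    rw [← Real.rpow_natCast, ← Real.rpow_mul hτ0, ← Real.rpow_natCast]; norm_num
  obtain ⟨r1, r2⟩ := integral_le_of_integral_rpow_le (P := P) (Y := fun ω => ‖N t ω‖ ^ 3)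
    (r := 4 / 3) (τ := τ ^ 3) (hm.norm.pow 3) (fun ω => by positivity) (by norm_num) (by positivity)
    (by simpa only [e4] using h4) (by simpa only [e4, e4'] using h4')
  refine ⟨r1, r2.trans ?_⟩
  have hd : 0 ≤ Real.log (Module.finrank ℝ E) := Real.log_natCast_nonneg _
  unfold effHessNoiseCube
  obtain ⟨l, hl, hl2⟩ : ∃ l : ℝ, 1 ≤ l ∧ 1 + Real.log (Module.finrank ℝ E) = l ^ 2 :=
    ⟨√(1 + Real.log (Module.finrank ℝ E)), Real.one_le_sqrt.2 (by linarith),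
      (Real.sq_sqrt (by linarith)).symm⟩
  have hl0 : 0 ≤ l := by linarith
  obtain ⟨g, hg, rfl⟩ : ∃ g : ℝ, 0 ≤ g ∧ γ = g ^ 2 := ⟨√γ, Real.sqrt_nonneg _, (Real.sq_sqrt hγ0.le).symm⟩
  rw [hl2] at hKd ⊢
  rw [rpow_three_halves_sq hg, rpow_three_halves_sq hl0]
  -- Here 3.9² > 15, the constant of the smooth norm.
  have hul : u ≤ 3.9 * l * g := by
    refine abs_le_of_sq_le_sq' ?_ (by positivity) |>.2
    rw [hu2]
    have := mul_le_mul_of_nonneg_right hKd (sq_nonneg g)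
    have : 0 ≤ l ^ 2 * g ^ 2 := by positivity
    linarith
  rw [Real.sqrt_sq hg] at hτ
  have h3 := add_pow_le hσ (mul_nonneg hg hδ) 3
  norm_num at h3
  -- The argument yields the power 3/2 of 1 + log d for δ as well; it is enlarged to 3 to match the
  -- stated noise level.
  have hl3 : l ^ 3 * (g * δ) ^ 3 ≤ (l ^ 2) ^ 3 * (g * δ) ^ 3 := by
    rw [← pow_mul]
    gcongr ?_ * _
    exact pow_le_pow_right₀ hl (by norm_num)
  have h0 : 0 ≤ l ^ 3 * σ ^ 3 * g ^ 3 := by positivity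
  calc τ ^ 3 = 8 * u ^ 3 * (σ + g * δ) ^ 3 := by rw [hτ]; ring
    _ ≤ 8 * (3.9 * l * g) ^ 3 * (4 * (σ ^ 3 + (g * δ) ^ 3)) := by gcongr
    _ = 1898.208 * (g ^ 3 * (l ^ 3 * σ ^ 3 + l ^ 3 * (g * δ) ^ 3)) := by ring
    _ ≤ 2000 * (g ^ 3 * (l ^ 3 * σ ^ 3 + (l ^ 2) ^ 3 * (g * δ) ^ 3)) := by gcongr; norm_num
    _ = _ := by ring

end HessianAverage

/-! ### Pathwise splitting of the errors into noise and bias, and summation. -/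

section Path

/-- The exponential moving average with weight `γ` of the terms `n 1, n 2, …`, started at `0`. -/
def movingAverage {V : Type*} [AddCommGroup V] [Module ℝ V] (γ : ℝ) (n : ℕ → V) : ℕ → V
  | 0 => 0
  | t + 1 => (1 - γ) • movingAverage γ n t + γ • n (t + 1)

/-- Summing γ a_t ≤ a_t - a_{t+1} + γ b_t telescopes. -/
lemma sum_le_of_contraction {γ : ℝ} (hγ : 0 < γ) {a b : ℕ → ℝ} (ha : ∀ t, 0 ≤ a t)
    (h : ∀ t, a (t + 1) ≤ (1 - γ) * a t + γ * b t) (T : ℕ) :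
    ∑ t ∈ Finset.range T, a t ≤ a 0 / γ + ∑ t ∈ Finset.range T, b t := by
  have key : γ * ∑ t ∈ Finset.range T, a t + a T ≤ a 0 + γ * ∑ t ∈ Finset.range T, b t := by
    induction T with
    | zero => simp
    | succ T ih =>
      rw [Finset.sum_range_succ, Finset.sum_range_succ]
      linarith [h T]
  have := ha T
  rw [div_add' _ _ _ hγ.ne', le_div_iff₀ hγ]
  linarith

lemma convexCombination_rpow_le {γ a b p : ℝ} (hγ : γ ∈ Set.Ioc (0 : ℝ) 1) (ha : 0 ≤ a) (hb : 0 ≤ b)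
    (hp : 1 ≤ p) : ((1 - γ) * a + γ * b) ^ p ≤ (1 - γ) * a ^ p + γ * b ^ p := by
  simpa using (convexOn_rpow hp).2 (Set.mem_Ici.2 ha) (Set.mem_Ici.2 hb) (sub_nonneg.2 hγ.2)
    hγ.1.le (by ring)

variable {E : Type*} [NormedAddCommGroup E] [InnerProductSpace ℝ E] [CompleteSpace E]
  {Ξ : Type*} {f : E → ℝ} {F : Ξ → E → ℝ} {L α β : ℝ}

/-- The point at which the gradient is sampled by implicit-transport momentum. -/
noncomputable def transportPoint (α : ℝ) (x : ℕ → E) (t : ℕ) : E :=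
  x t + ((1 - α) / α) • (x t - x (t - 1))

/-- The averaged gradient noise along a path. -/
noncomputable def gradNoiseAverage (f : E → ℝ) (F : Ξ → E → ℝ) (α : ℝ) (ξ : ℕ → Ξ) (x : ℕ → E) : ℕ → E :=
  movingAverage α fun t => gradient (F (ξ t)) (transportPoint α x t)
    - gradient f (transportPoint α x t)

/-- The averaged Hessian noise along a path. -/
noncomputable def hessNoiseAverage (f : E → ℝ) (F : Ξ → E → ℝ) (β : ℝ) (ξ : ℕ → Ξ) (x : ℕ → E) :
    ℕ → E →L[ℝ] E :=
  movingAverage β fun t => hessian (F (ξ t)) (x t) - hessian f (x t)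

/-- The average of x and the extrapolated point with weights 1-α and α is exactly y, so the
first-order terms of the expansions at y cancel and only quadratic remainders survive. The factor α
is kept outside to fit the contraction lemma. -/
lemma IsObjective.norm_transport_le (hf : IsObjective f L) (hα : α ∈ Set.Ioc (0 : ℝ) 1) (x y : E) :
    ‖(1 - α) • gradient f x + α • gradient f (y + ((1 - α) / α) • (y - x)) - gradient f y‖
      ≤ α * (L / (2 * α ^ 2) * ‖y - x‖ ^ 2) := by
  obtain ⟨h0, h1⟩ := hα
  have h1' := sub_nonneg.2 h1
  set c := (1 - α) / α with hc
  have hαc : α * c = 1 - α := by rw [hc]; field_simp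
  have ha := hf.norm_gradient_sub_le y (-(y - x))
  have hb := hf.norm_gradient_sub_le y (c • (y - x))
  rw [show y + -(y - x) = x by abel, norm_neg] at ha
  rw [norm_smul, mul_pow, Real.norm_eq_abs, sq_abs] at hb
  have e : (1 - α) • gradient f x + α • gradient f (y + c • (y - x)) - gradient f y
      = (1 - α) • (gradient f x - gradient f y - hessian f y (-(y - x)))
        + α • (gradient f (y + c • (y - x)) - gradient f y - hessian f y (c • (y - x))) := by
    rw [map_neg, map_smul]
    simp only [smul_sub, smul_smul, hαc, sub_smul, one_smul, smul_neg]
    abel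
  rw [e]
  refine (norm_add_le _ _).trans ?_
  rw [norm_smul, norm_smul, Real.norm_of_nonneg h1', Real.norm_of_nonneg h0.le]
  have hn : 0 ≤ L / 2 * ‖y - x‖ ^ 2 := (norm_nonneg _).trans ha
  calc _ ≤ (1 - α) * (L / 2 * ‖y - x‖ ^ 2) + α * (L / 2 * (c ^ 2 * ‖y - x‖ ^ 2)) := by gcongr
    _ = (1 - α) / α * (L / 2 * ‖y - x‖ ^ 2) := by rw [hc]; field_simp; ring
    _ ≤ 1 / α * (L / 2 * ‖y - x‖ ^ 2) := by gcongr; linarith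
    _ = _ := by field_simp

lemma IsObjective.nonneg [Nontrivial E] (hf : IsObjective f L) : 0 ≤ L := by
  obtain ⟨x, hx⟩ := exists_ne (0 : E)
  have h := (norm_nonneg _).trans (hf.lipschitz_hessian x 0)
  rw [sub_zero] at h
  exact (mul_nonneg_iff_of_pos_right (norm_pos_iff.2 hx)).1 h

lemma IsObjective.sum_grad_bias_le [Nontrivial E] (hf : IsObjective f L)
    (hα : α ∈ Set.Ioc (0 : ℝ) 1) (ξ : ℕ → Ξ) (x : ℕ → E) (T : ℕ) :
    ∑ t ∈ Finset.range T,
        ‖gradEst F α ξ x t - gradient f (x t) - gradNoiseAverage f F α ξ x t‖ ^ (3 / 2 : ℝ)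
      ≤ ‖gradient (F (ξ 0)) (x 0) - gradient f (x 0)‖ ^ (3 / 2 : ℝ) / α
        + L ^ (3 / 2 : ℝ) / α ^ 3 * ∑ t ∈ Finset.range T, ‖x (t + 1) - x t‖ ^ 3 := by
  have hL := hf.nonneg
  have hα0 := hα.1
  -- W is the bias. Its recursion contains no fresh noise, and since the noise average starts at 0,
  -- the whole initial error sits in W 0.
  set W : ℕ → E := fun t => gradEst F α ξ x t - gradient f (x t) - gradNoiseAverage f F α ξ x t
    with hW
  have hrec : ∀ t, ‖W (t + 1)‖ ≤ (1 - α) * ‖W t‖ + α * (L / (2 * α ^ 2) * ‖x (t + 1) - x t‖ ^ 2) := by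
    intro t
    have e : W (t + 1) = (1 - α) • W t + ((1 - α) • gradient f (x t)
        + α • gradient f (x (t + 1) + ((1 - α) / α) • (x (t + 1) - x t)) - gradient f (x (t + 1))) := by
      simp only [hW, gradEst, gradNoiseAverage, movingAverage, transportPoint, Nat.add_sub_cancel]
      simp only [smul_sub]
      abel
    rw [e]
    refine (norm_add_le _ _).trans ?_
    rw [norm_smul, Real.norm_of_nonneg (sub_nonneg.2 hα.2)]
    gcongr
    exact hf.norm_transport_le hα _ _
  have h := sum_le_of_contraction hα0 (a := fun t => ‖W t‖ ^ (3 / 2 : ℝ))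
    (b := fun t => L ^ (3 / 2 : ℝ) / α ^ 3 * ‖x (t + 1) - x t‖ ^ 3)
    (fun t => by positivity) (fun t => ?_) T
  · rw [← Finset.mul_sum] at h
    have e0 : W 0 = gradient (F (ξ 0)) (x 0) - gradient f (x 0) := by
      simp [hW, gradEst, gradNoiseAverage, movingAverage]
    simp only [e0] at h
    exact h
  -- Convexity of the power preserves the contraction factor 1 - α and turns the quadratic drift
  -- into a cube of the step length.
  · have e : (L / α ^ 2 * ‖x (t + 1) - x t‖ ^ 2) ^ (3 / 2 : ℝ)
        = L ^ (3 / 2 : ℝ) / α ^ 3 * ‖x (t + 1) - x t‖ ^ 3 := by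
      rw [Real.mul_rpow (by positivity) (by positivity), Real.div_rpow hL (by positivity),
        rpow_three_halves_sq hα0.le, rpow_three_halves_sq (norm_nonneg _)]
    simp only [← e]
    refine le_trans ?_ (convexCombination_rpow_le hα (norm_nonneg _) (by positivity) (by norm_num))
    gcongr
    refine (hrec t).trans ?_
    gcongr
    nlinarith [sq_nonneg α]

lemma IsObjective.sum_hess_bias_le [Nontrivial E] (hf : IsObjective f L)
    (hβ : β ∈ Set.Ioc (0 : ℝ) 1) (ξ : ℕ → Ξ) (x : ℕ → E) (T : ℕ) :
    ∑ t ∈ Finset.range T,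
        ‖hessEst F β ξ x t - hessian f (x t) - hessNoiseAverage f F β ξ x t‖ ^ 3
      ≤ ‖hessian (F (ξ 0)) (x 0) - hessian f (x 0)‖ ^ 3 / β
        + L ^ 3 / β ^ 3 * ∑ t ∈ Finset.range T, ‖x (t + 1) - x t‖ ^ 3 := by
  have hL := hf.nonneg
  have hβ0 := hβ.1
  have hβ1 := sub_nonneg.2 hβ.2
  set W : ℕ → E →L[ℝ] E :=
    fun t => hessEst F β ξ x t - hessian f (x t) - hessNoiseAverage f F β ξ x t with hW
  have hrec : ∀ t, ‖W (t + 1)‖ ≤ (1 - β) * ‖W t‖ + β * (L / β * ‖x (t + 1) - x t‖) := by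
    intro t
    have e : W (t + 1) = (1 - β) • W t + (1 - β) • (hessian f (x t) - hessian f (x (t + 1))) := by
      simp only [hW, hessEst, hessNoiseAverage, movingAverage]
      simp only [smul_sub, sub_smul, one_smul]
      abel
    rw [e]
    refine (norm_add_le _ _).trans ?_
    rw [norm_smul, norm_smul, Real.norm_of_nonneg hβ1]
    have h1 := hf.lipschitz_hessian (x t) (x (t + 1))
    rw [norm_sub_rev (x t)] at h1
    have h2 : (1 - β) * ‖hessian f (x t) - hessian f (x (t + 1))‖
        ≤ β * (L / β * ‖x (t + 1) - x t‖) := by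
      calc _ ≤ 1 * (L * ‖x (t + 1) - x t‖) := by gcongr; linarith
        _ = _ := by field_simp
    linarith
  have h := sum_le_of_contraction hβ0 (a := fun t => ‖W t‖ ^ 3)
    (b := fun t => L ^ 3 / β ^ 3 * ‖x (t + 1) - x t‖ ^ 3)
    (fun t => by positivity) (fun t => ?_) T
  · rw [← Finset.mul_sum] at h
    have e0 : W 0 = hessian (F (ξ 0)) (x 0) - hessian f (x 0) := by
      simp [hW, hessEst, hessNoiseAverage, movingAverage]
    simp only [e0] at h
    exact h
  · have e : (L / β * ‖x (t + 1) - x t‖) ^ 3 = L ^ 3 / β ^ 3 * ‖x (t + 1) - x t‖ ^ 3 := by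
      rw [mul_pow, div_pow]
    simp only [← e]
    have hc := convexCombination_rpow_le hβ (norm_nonneg (W t))
      (by positivity : 0 ≤ L / β * ‖x (t + 1) - x t‖) (p := (3 : ℕ)) (by norm_num)
    simp only [Real.rpow_natCast] at hc
    refine le_trans ?_ hc
    gcongr
    exact hrec t

lemma rpow_add_three_halves_le {a b : ℝ} (ha : 0 ≤ a) (hb : 0 ≤ b) :
    (a + b) ^ (3 / 2 : ℝ) ≤ √3 * (a ^ (3 / 2 : ℝ) + b ^ (3 / 2 : ℝ)) := by
  have h : (a + b) ^ (3 / 2 : ℝ) ≤ 2 ^ (3 / 2 - 1 : ℝ) * (a ^ (3 / 2 : ℝ) + b ^ (3 / 2 : ℝ)) := by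
    lift a to NNReal using ha
    lift b to NNReal using hb
    exact_mod_cast NNReal.rpow_add_le_mul_rpow_add_rpow a b (p := 3 / 2) (by norm_num)
  refine h.trans ?_
  gcongr
  rw [show (3 / 2 - 1 : ℝ) = 1 / 2 by norm_num, ← Real.sqrt_eq_rpow]
  exact Real.sqrt_le_sqrt (by norm_num)

lemma isSymmetric_hessEst (hF : ∀ s, TwiceDifferentiable (F s)) (ξ : ℕ → Ξ) (x : ℕ → E) (t : ℕ) :
    (hessEst F β ξ x t : E →ₗ[ℝ] E).IsSymmetric := by
  induction t with
  | zero => exact (hF _).isSymmetric_hessian _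
  | succ t ih =>
    exact isSymmetric_line (ih.smul (by simp)) ((hF _).isSymmetric_hessian _) β

variable [FiniteDimensional ℝ E] [Nontrivial E]

lemma IsObjective.sum_mu_le {M : ℝ} (hf : IsObjective f L) (hF : ∀ s, TwiceDifferentiable (F s))
    (hM : 0 < M) (hL : L ≤ M) (hα : α ∈ Set.Ioc (0 : ℝ) 1) (hβ : β ∈ Set.Ioc (0 : ℝ) 1)
    (hpar : ParamCondition L M α β) (ξg ξh : ℕ → Ξ) (x : ℕ → E) (T : ℕ)
    (hstep : ∀ t < T, IsMinOn (cubicModel M (gradEst F α ξg x t) (hessEst F β ξh x t) (x t))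
      Set.univ (x (t + 1))) :
    ∑ t ∈ Finset.range T, mu f M (x (t + 1)) ≤ 10000 * (√M * gap f (x 0)
      + 8 * (∑ t ∈ Finset.range T, ‖gradNoiseAverage f F α ξg x t‖ ^ (3 / 2 : ℝ)
        + ‖gradient (F (ξg 0)) (x 0) - gradient f (x 0)‖ ^ (3 / 2 : ℝ) / α)
      + 292 / M ^ (3 / 2 : ℝ) * (∑ t ∈ Finset.range T, ‖hessNoiseAverage f F β ξh x t‖ ^ 3
        + ‖hessian (F (ξh 0)) (x 0) - hessian f (x 0)‖ ^ 3 / β)) := by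
  have hα0 := hα.1
  have hβ0 := hβ.1
  have hg := hf.sum_grad_bias_le (F := F) hα ξg x T
  have hh := hf.sum_hess_bias_le (F := F) hβ ξh x T
  set D := ∑ t ∈ Finset.range T, ‖x (t + 1) - x t‖ ^ 3
  set A := ∑ t ∈ Finset.range T, ‖gradNoiseAverage f F α ξg x t‖ ^ (3 / 2 : ℝ)
  set B := ∑ t ∈ Finset.range T, ‖hessNoiseAverage f F β ξh x t‖ ^ 3
  set a0 := ‖gradient (F (ξg 0)) (x 0) - gradient f (x 0)‖ ^ (3 / 2 : ℝ) / α
  set b0 := ‖hessian (F (ξh 0)) (x 0) - hessian f (x 0)‖ ^ 3 / β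
  have hD : 0 ≤ D := Finset.sum_nonneg fun t _ => by positivity
  have hA : 0 ≤ A := Finset.sum_nonneg fun t _ => by positivity
  have hB : 0 ≤ B := Finset.sum_nonneg fun t _ => by positivity
  have ha0 : 0 ≤ a0 := by positivity
  have hb0 : 0 ≤ b0 := by positivity
  have hM0 : 0 < M ^ (3 / 2 : ℝ) := by positivity
  have hL0 := hf.nonneg
  have hgs : ∑ t ∈ Finset.range T, ‖gradEst F α ξg x t - gradient f (x t)‖ ^ (3 / 2 : ℝ)
      ≤ √3 * (A + (a0 + L ^ (3 / 2 : ℝ) / α ^ 3 * D)) := by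
    refine le_trans ?_ (mul_le_mul_of_nonneg_left (add_le_add_right hg A) (Real.sqrt_nonneg 3))
    rw [← Finset.sum_add_distrib, Finset.mul_sum]
    refine Finset.sum_le_sum fun t _ => ?_
    refine le_trans ?_ (rpow_add_three_halves_le (norm_nonneg _) (norm_nonneg _))
    gcongr
    refine (norm_add_le _ _).trans_eq' ?_
    rw [add_sub_cancel]
  have hhs : ∑ t ∈ Finset.range T, ‖hessEst F β ξh x t - hessian f (x t)‖ ^ 3
      ≤ 4 * (B + (b0 + L ^ 3 / β ^ 3 * D)) := by
    refine le_trans ?_ (mul_le_mul_of_nonneg_left (add_le_add_right hh B) (by norm_num))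
    rw [← Finset.sum_add_distrib, Finset.mul_sum]
    refine Finset.sum_le_sum fun t _ => ?_
    have := add_pow_le (norm_nonneg (hessNoiseAverage f F β ξh x t))
      (norm_nonneg (hessEst F β ξh x t - hessian f (x t) - hessNoiseAverage f F β ξh x t)) 3
    norm_num at this
    refine le_trans ?_ this
    gcongr
    refine (norm_add_le _ _).trans_eq' ?_
    rw [add_sub_cancel]
  have hsum := Finset.sum_le_sum fun t (ht : t ∈ Finset.range T) =>
    hf.cubic_step_progress hM hL (isSymmetric_hessEst hF ξh x t) (hstep t (Finset.mem_range.1 ht))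
  simp only [Finset.sum_add_distrib, ← Finset.mul_sum, ← Finset.sum_div] at hsum
  have htel : ∑ t ∈ Finset.range T, (f (x t) - f (x (t + 1))) ≤ gap f (x 0) := by
    rw [Finset.sum_range_sub']
    have := ciInf_le hf.bdd_below (x T)
    unfold gap
    linarith
  have h1 : √M * ∑ t ∈ Finset.range T, (f (x t) - f (x (t + 1))) ≤ √M * gap f (x 0) := by gcongr
  have h2 : 73 / M ^ (3 / 2 : ℝ) * ∑ t ∈ Finset.range T, ‖hessEst F β ξh x t - hessian f (x t)‖ ^ 3
      ≤ 73 / M ^ (3 / 2 : ℝ) * (4 * (B + (b0 + L ^ 3 / β ^ 3 * D))) := by gcongr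
  -- The parameter condition lets the spare cubes of the step lengths pay for both biases. Splitting
  -- the Hessian cubes costs the factor 4, less than the 9 in the condition; `h5` discards the
  -- surplus.
  have h3 := mul_le_mul_of_nonneg_right hpar hD
  have h4 : √3 * (A + a0) ≤ 2 * (A + a0) := by
    gcongr
    rw [Real.sqrt_le_left (by norm_num)]; norm_num
  have h5 : 0 ≤ 73 / M ^ (3 / 2 : ℝ) * (L ^ 3 / β ^ 3 * D) := by positivity
  have e1 : (4 * √3 * L ^ (3 / 2 : ℝ) / α ^ 3 + 73 / M ^ (3 / 2 : ℝ) * (9 * L ^ 3 / β ^ 3)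
      - M ^ (3 / 2 : ℝ) / 72) * D = 4 * (√3 * (L ^ (3 / 2 : ℝ) / α ^ 3 * D))
      + 9 * (73 / M ^ (3 / 2 : ℝ) * (L ^ 3 / β ^ 3 * D)) - M ^ (3 / 2 : ℝ) / 72 * D := by ring
  rw [e1, zero_mul] at h3
  have e2 : 292 / M ^ (3 / 2 : ℝ) * (B + b0) = 4 * (73 / M ^ (3 / 2 : ℝ) * (B + b0)) := by ring
  rw [e2]
  linarith

end Path

/-! ### Expectation at a uniformly random index. -/

section UniformOutput

variable {E : Type*} [MeasurableSpace E] {Ω : Type*} [MeasurableSpace Ω] {P : Measure Ω}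
  [IsProbabilityMeasure P] {T : ℕ} {x : ℕ → Ω → E} {xout : Ω → E}

/-- Almost surely φ at the output is a sum over t of the indicator of τ = t + 1 times φ at that
iterate. Independence factors each expectation, and each event has probability 1/T. -/
lemma IsUniformOutput.integral_eq (h : IsUniformOutput P T x xout) {φ : E → ℝ}
    (hφ : Measurable φ) (hi : ∀ t < T, Integrable (fun ω => φ (x (t + 1) ω)) P) :
    Integrable (fun ω => φ (xout ω)) P ∧
    ∫ ω, φ (xout ω) ∂P = (∑ t ∈ Finset.range T, ∫ ω, φ (x (t + 1) ω) ∂P) / T := by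
  obtain ⟨τ, hτ, hunif, hind, hx⟩ := h
  have hprob : ∀ t < T, P.real (τ ⁻¹' {t + 1}) = 1 / T := fun t ht => by
    rw [Measure.real, ← Measure.map_apply hτ (measurableSet_singleton _), hunif]
    have := uniformOn_apply_finset (s := Finset.Icc 1 T) (t := {t + 1})
    rw [Finset.coe_Icc, Finset.coe_singleton] at this
    rw [this, Finset.inter_singleton_of_mem (by simp; omega)]
    simp
  have hpiece : ∀ t < T,
      Integrable (fun ω => (τ ⁻¹' {t + 1}).indicator 1 ω * φ (x (t + 1) ω)) P ∧
      ∫ ω, (τ ⁻¹' {t + 1}).indicator 1 ω * φ (x (t + 1) ω) ∂P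
        = (∫ ω, φ (x (t + 1) ω) ∂P) / T := fun t ht => by
    have hms : MeasurableSet (τ ⁻¹' {t + 1}) := hτ (measurableSet_singleton _)
    have hind' : IndepFun (fun ω => (τ ⁻¹' {t + 1}).indicator (1 : Ω → ℝ) ω)
        (fun ω => φ (x (t + 1) ω)) P :=
      hind.comp (φ := ({t + 1} : Set ℕ).indicator (1 : ℕ → ℝ))
        (ψ := fun w : Fin (T + 1) → E => φ (w ⟨t + 1, by omega⟩))
        (measurable_of_countable _) (hφ.comp (measurable_pi_apply _))
    have hii : Integrable (fun ω => (τ ⁻¹' {t + 1}).indicator (1 : Ω → ℝ) ω) P :=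
      (integrable_const 1).indicator hms
    refine ⟨hind'.integrable_mul hii (hi t ht), ?_⟩
    rw [hind'.integral_fun_mul_eq_mul_integral hii.1 (hi t ht).1, integral_indicator_one hms,
      hprob t ht]
    ring
  have hae : (fun ω => φ (xout ω)) =ᵐ[P]
      fun ω => ∑ t ∈ Finset.range T, (τ ⁻¹' {t + 1}).indicator 1 ω * φ (x (t + 1) ω) := by
    have hmem : ∀ᵐ ω ∂P, τ ω ∈ Set.Icc 1 T := by
      have : ∀ᵐ k ∂(P.map τ), k ∈ Set.Icc 1 T := by
        rw [hunif]
        exact ae_cond_mem (Set.finite_Icc 1 T).measurableSet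
      exact ae_of_ae_map hτ.aemeasurable this
    filter_upwards [hmem] with ω hω
    rw [hx, Finset.sum_eq_single (τ ω - 1)]
    · have : τ ω - 1 + 1 = τ ω := Nat.sub_add_cancel hω.1
      rw [this]
      simp
    · intro t _ ht
      rw [Set.indicator_of_notMem (by simp; omega), zero_mul]
    · intro h'
      exact absurd (Finset.mem_range.2 (by have := hω.1; have := hω.2; omega)) h'
  refine ⟨(integrable_congr hae).2 (integrable_finsetSum _ fun t ht =>
    (hpiece t (Finset.mem_range.1 ht)).1), ?_⟩
  rw [integral_congr_ae hae, integral_finsetSum _ fun t ht => (hpiece t (Finset.mem_range.1 ht)).1,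
    Finset.sum_div]
  exact Finset.sum_congr rfl fun t ht => (hpiece t (Finset.mem_range.1 ht)).2

end UniformOutput

/-! ### The expected rate along a run. -/

section Run

variable {E : Type*} [NormedAddCommGroup E] [InnerProductSpace ℝ E] [FiniteDimensional ℝ E]
  [MeasurableSpace E] [BorelSpace E]
  {Ω : Type*} [MeasurableSpace Ω] {P : Measure Ω}
  {Ξ : Type*} [MeasurableSpace Ξ] {f : E → ℝ} {F : Ξ → E → ℝ} {x₀ : E}
  {L M α β σ δ : ℝ} {T : ℕ} {ξg ξh : ℕ → Ω → Ξ}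
  {ℱ : Filtration ℕ (inferInstance : MeasurableSpace Ω)} {x : ℕ → Ω → E} {xout : Ω → E}

lemma IsRun.isNoiseAverage_grad (h : IsRun P ℱ F x₀ M α β T ξg ξh x) (hf : IsObjective f L)
    (hF : IsStochasticFamily F) :
    IsNoiseAverage P ℱ T α (fun p : Ξ × E => gradient (F p.1) p.2 - gradient f p.2) ξg
      (fun t ω => transportPoint α (fun s => x s ω) t)
      (fun t ω => gradNoiseAverage f F α (fun s => ξg s ω) (fun s => x s ω) t) where
  measurable_noise := hF.measurable_gradient.sub
    (hf.twice_diff.2.continuous.measurable.comp measurable_snd)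
  measurable_sample := h.measurable_grad_sample
  indep := h.indep_grad_sample
  adapted t ht := by
    have h1 := h.adapted t ht.le
    -- At t = 0 truncated subtraction gives `x 0`, so the extrapolation is trivial there.
    have h2 : Measurable[ℱ t] (x (t - 1)) :=
      (h.adapted (t - 1) (by omega)).mono (ℱ.mono (by omega)) le_rfl
    exact h1.add ((h1.sub h2).const_smul _)
  zero _ := rfl
  succ _ _ := rfl

lemma IsRun.isNoiseAverage_hess (h : IsRun P ℱ F x₀ M α β T ξg ξh x) (hf : IsObjective f L)
    (hF : IsStochasticFamily F) :
    IsNoiseAverage P ℱ T β (fun p : Ξ × E => hessian (F p.1) p.2 - hessian f p.2) ξh x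
      (fun t ω => hessNoiseAverage f F β (fun s => ξh s ω) (fun s => x s ω) t) where
  measurable_noise := hF.measurable_hessian.sub
    (hf.continuous_hessian.measurable.comp measurable_snd)
  measurable_sample := h.measurable_hess_sample
  indep := h.indep_hess_sample
  adapted t ht := h.adapted t ht.le
  zero _ := rfl
  succ _ _ := rfl

variable [IsProbabilityMeasure P]

lemma IsRun.integral_gradNoiseAverage_le (h : IsRun P ℱ F x₀ M α β T ξg ξh x)
    (hf : IsObjective f L) (hF : IsStochasticFamily F) (hα : α ∈ Set.Ioc (0 : ℝ) 1) (hσ : 0 ≤ σ)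
    (hn : ∀ t, 1 ≤ t → t < T → GradientNoise P f F (ξg t) σ) {t : ℕ} (ht : t < T) :
    Integrable (fun ω => ‖gradNoiseAverage f F α (fun s => ξg s ω) (fun s => x s ω) t‖
      ^ (3 / 2 : ℝ)) P ∧
    ∫ ω, ‖gradNoiseAverage f F α (fun s => ξg s ω) (fun s => x s ω) t‖ ^ (3 / 2 : ℝ) ∂P
      ≤ α ^ (3 / 4 : ℝ) * σ ^ (3 / 2 : ℝ) := by
  have hN := h.isNoiseAverage_grad hf hF
  have hα0 := hα.1.le
  obtain ⟨h1, h2⟩ := hN.integral_norm_sq_le (σ := σ) hα (fun t h1 h2 z => by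
    have := hn t h1 h2
    refine ⟨(this.integrable z).sub (integrable_const (gradient f z)), ?_, this.integrable_sq z,
      this.variance_le z⟩
    rw [integral_sub (this.integrable z) (integrable_const (gradient f z)), this.unbiased]
    simp) t ht
  have e : ∀ ω, (‖gradNoiseAverage f F α (fun s => ξg s ω) (fun s => x s ω) t‖ ^ (3 / 2 : ℝ))
      ^ (4 / 3 : ℝ) = ‖gradNoiseAverage f F α (fun s => ξg s ω) (fun s => x s ω) t‖ ^ 2 := fun ω => by
    rw [← Real.rpow_mul (norm_nonneg _), ← Real.rpow_natCast]; norm_num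
  have e' : (α ^ (3 / 4 : ℝ) * σ ^ (3 / 2 : ℝ)) ^ (4 / 3 : ℝ) = α * σ ^ 2 := by
    rw [Real.mul_rpow (by positivity) (by positivity), ← Real.rpow_mul hα0, ← Real.rpow_mul hσ,
      ← Real.rpow_natCast]
    norm_num
  refine integral_le_of_integral_rpow_le (r := 4 / 3) ?_ (fun ω => by positivity) (by norm_num)
    (by positivity) (by simpa only [e] using h1) (by simpa only [e, e'] using h2)
  exact ((hN.aestronglyMeasurable ht).norm.aemeasurable.pow_const _).aestronglyMeasurable

lemma IsRun.integral_hessNoiseAverage_le (h : IsRun P ℱ F x₀ M α β T ξg ξh x)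
    (hf : IsObjective f L) (hF : IsStochasticFamily F) (hβ : β ∈ Set.Ioc (0 : ℝ) 1)
    (hE : 1 ≤ Module.finrank ℝ E) (hσ : 0 ≤ σ) (hδ : 0 ≤ δ)
    (hn : ∀ t, 1 ≤ t → t < T → HessianNoise P f F (ξh t) σ δ) {t : ℕ} (ht : t < T) :
    Integrable (fun ω => ‖hessNoiseAverage f F β (fun s => ξh s ω) (fun s => x s ω) t‖ ^ 3) P ∧
    ∫ ω, ‖hessNoiseAverage f F β (fun s => ξh s ω) (fun s => x s ω) t‖ ^ 3 ∂P
      ≤ 2000 * (β ^ (3 / 2 : ℝ) * effHessNoiseCube (Module.finrank ℝ E) β σ δ) := by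
  refine (h.isNoiseAverage_hess hf hF).integral_norm_pow_three_le (fun p =>
    ((hF.twice_diff _).isSymmetric_hessian _).sub (hf.twice_diff.isSymmetric_hessian _))
    hβ hE hσ hδ (fun t h1 h2 z => ?_) ht
  have := hn t h1 h2
  refine ⟨(this.integrable z).sub (integrable_const (hessian f z)), ?_, this.integrable_sq z,
    this.variance_le z, this.bounded z⟩
  rw [integral_sub (this.integrable z) (integrable_const (hessian f z)), this.unbiased]
  simp

lemma InitialGradientNoise.integral_rpow_le {ξ : Ω → Ξ} (hF : IsStochasticFamily F)
    (hξ : Measurable ξ) (hσ : 0 ≤ σ) (h : InitialGradientNoise P f F ξ x₀ σ) :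
    Integrable (fun ω => ‖gradient (F (ξ ω)) x₀ - gradient f x₀‖ ^ (3 / 2 : ℝ)) P ∧
    ∫ ω, ‖gradient (F (ξ ω)) x₀ - gradient f x₀‖ ^ (3 / 2 : ℝ) ∂P ≤ σ ^ (3 / 2 : ℝ) := by
  have e : ∀ a : ℝ, 0 ≤ a → (a ^ (3 / 2 : ℝ)) ^ (4 / 3 : ℝ) = a ^ 2 := fun a ha => by
    rw [← Real.rpow_mul ha, ← Real.rpow_natCast]; norm_num
  refine integral_le_of_integral_rpow_le (r := 4 / 3) ?_ (fun ω => by positivity) (by norm_num)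
    (by positivity) ?_ ?_
  · have : Measurable fun ω => gradient (F (ξ ω)) x₀ :=
      hF.measurable_gradient.comp (hξ.prodMk measurable_const)
    exact ((this.sub_const _).norm.pow_const _).aestronglyMeasurable
  · simpa only [e _ (norm_nonneg _)] using h.integrable
  · simpa only [e _ (norm_nonneg _), e _ hσ] using h.moment_le

/-- The rate of Cubic Newton with momentum, in terms of the dimension `finrank ℝ E`. -/
lemma IsRun.integral_mu_le {σg σh δh σg0 σh0 : ℝ} (h : IsRun P ℱ F x₀ M α β T ξg ξh x)
    (hE : 1 ≤ Module.finrank ℝ E) (hT : 1 ≤ T)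
    (hσg0 : 0 ≤ σg0) (hσg : 0 ≤ σg) (hσh : 0 ≤ σh) (hδh : 0 ≤ δh) (hσh0 : 0 ≤ σh0)
    (hα : α ∈ Set.Ioc (0 : ℝ) 1) (hβ : β ∈ Set.Ioc (0 : ℝ) 1) (hM : 0 < M) (hL : L ≤ M)
    (hpar : ParamCondition L M α β) (hf : IsObjective f L) (hF : IsStochasticFamily F)
    (hg : ∀ t, 1 ≤ t → t < T → GradientNoise P f F (ξg t) σg)
    (hh : ∀ t, 1 ≤ t → t < T → HessianNoise P f F (ξh t) σh δh)
    (hg0 : InitialGradientNoise P f F (ξg 0) x₀ σg0)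
    (hh0 : InitialHessianNoise P f F (ξh 0) x₀ σh0) (hout : IsUniformOutput P T x xout) :
    Integrable (fun ω => mu f M (xout ω)) P ∧ ∫ ω, mu f M (xout ω) ∂P ≤
      10 ^ 10 * rate (Module.finrank ℝ E) T (gap f x₀) M α β σg0 σh0 σg σh δh := by
  have hα0 := hα.1
  have hβ0 := hβ.1
  have : Nontrivial E := Module.nontrivial_of_finrank_pos (R := ℝ) hE
  have hM0 : 0 < M ^ (3 / 2 : ℝ) := by positivity
  set N : ℕ → Ω → ℝ := fun t ω =>
    ‖gradNoiseAverage f F α (fun s => ξg s ω) (fun s => x s ω) t‖ ^ (3 / 2 : ℝ)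
  set S : ℕ → Ω → ℝ := fun t ω =>
    ‖hessNoiseAverage f F β (fun s => ξh s ω) (fun s => x s ω) t‖ ^ 3
  set a : Ω → ℝ := fun ω => ‖gradient (F (ξg 0 ω)) x₀ - gradient f x₀‖ ^ (3 / 2 : ℝ)
  set b : Ω → ℝ := fun ω => ‖hessian (F (ξh 0 ω)) x₀ - hessian f x₀‖ ^ 3
  have hN : ∀ t ∈ Finset.range T, Integrable (N t) P ∧
      ∫ ω, N t ω ∂P ≤ α ^ (3 / 4 : ℝ) * σg ^ (3 / 2 : ℝ) := fun t ht =>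
    h.integral_gradNoiseAverage_le hf hF hα hσg hg (Finset.mem_range.1 ht)
  have hS : ∀ t ∈ Finset.range T, Integrable (S t) P ∧
      ∫ ω, S t ω ∂P ≤ 2000 * (β ^ (3 / 2 : ℝ) * effHessNoiseCube (Module.finrank ℝ E) β σh δh) :=
    fun t ht => h.integral_hessNoiseAverage_le hf hF hβ hE hσh hδh hh (Finset.mem_range.1 ht)
  obtain ⟨ha, ha'⟩ : Integrable a P ∧ ∫ ω, a ω ∂P ≤ σg0 ^ (3 / 2 : ℝ) :=
    hg0.integral_rpow_le hF ((h.measurable_grad_sample 0 hT).mono (ℱ.le _) le_rfl) hσg0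
  have hb : Integrable b P := hh0.integrable
  have hb' : ∫ ω, b ω ∂P ≤ σh0 ^ 3 := hh0.moment_le
  have hpath : ∀ ω, ∑ t ∈ Finset.range T, mu f M (x (t + 1) ω) ≤ 10000 * (√M * gap f x₀
      + 8 * (∑ t ∈ Finset.range T, N t ω + a ω / α)
      + 292 / M ^ (3 / 2 : ℝ) * (∑ t ∈ Finset.range T, S t ω + b ω / β)) := fun ω => by
    have := hf.sum_mu_le hF.twice_diff hM hL hα hβ hpar (fun s => ξg s ω) (fun s => ξh s ω)
      (fun s => x s ω) T (fun t ht => h.cubic_step t ht ω)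
    simp only [h.start ω] at this
    exact this
  have hNi : Integrable (fun ω => ∑ t ∈ Finset.range T, N t ω) P :=
    integrable_finsetSum _ fun t ht => (hN t ht).1
  have hSi : Integrable (fun ω => ∑ t ∈ Finset.range T, S t ω) P :=
    integrable_finsetSum _ fun t ht => (hS t ht).1
  have hNa : Integrable (fun ω => ∑ t ∈ Finset.range T, N t ω + a ω / α) P :=
    hNi.add (ha.div_const α)
  have hSb : Integrable (fun ω => ∑ t ∈ Finset.range T, S t ω + b ω / β) P :=
    hSi.add (hb.div_const β)
  have hG1 : Integrable (fun ω => √M * gap f x₀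
      + 8 * (∑ t ∈ Finset.range T, N t ω + a ω / α)) P :=
    (integrable_const _).add (hNa.const_mul 8)
  have hG2 := hSb.const_mul (292 / M ^ (3 / 2 : ℝ))
  have hG : Integrable (fun ω => 10000 * (√M * gap f x₀
      + 8 * (∑ t ∈ Finset.range T, N t ω + a ω / α)
      + 292 / M ^ (3 / 2 : ℝ) * (∑ t ∈ Finset.range T, S t ω + b ω / β))) P :=
    (hG1.add hG2).const_mul 10000
  -- Integrability is not assumed: each nonnegative term is dominated by the pathwise bound, which
  -- is integrable.
  have hmi : ∀ t < T, Integrable (fun ω => mu f M (x (t + 1) ω)) P := fun t ht => by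
    have hm : Measurable (x (t + 1)) := (h.adapted (t + 1) ht).mono (ℱ.le _) le_rfl
    refine hG.mono' ((hf.continuous_mu M).measurable.comp hm).aestronglyMeasurable
      (ae_of_all _ fun ω => ?_)
    rw [Real.norm_of_nonneg (mu_nonneg _ _ _)]
    exact (Finset.single_le_sum (f := fun t => mu f M (x (t + 1) ω))
      (fun t _ => mu_nonneg _ _ _) (Finset.mem_range.2 ht)).trans (hpath ω)
  obtain ⟨hi, hout⟩ := hout.integral_eq (hf.continuous_mu M).measurable hmi
  refine ⟨hi, ?_⟩
  have hle := integral_mono (integrable_finsetSum _ fun t ht => hmi t (Finset.mem_range.1 ht))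
    hG hpath
  rw [integral_finsetSum _ fun t ht => hmi t (Finset.mem_range.1 ht), integral_const_mul,
    integral_add hG1 hG2, integral_add (integrable_const _) (hNa.const_mul 8),
    integral_const_mul 8, integral_const_mul (292 / M ^ (3 / 2 : ℝ)), integral_add hNi (ha.div_const α), integral_add hSi (hb.div_const β),
    integral_finsetSum _ fun t ht => (hN t ht).1, integral_finsetSum _ fun t ht => (hS t ht).1,
    integral_div, integral_div] at hle
  simp only [integral_const, probReal_univ, one_smul] at hle
  have hNs := Finset.sum_le_card_nsmul _ _ _ fun t ht => (hN t ht).2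
  have hSs := Finset.sum_le_card_nsmul _ _ _ fun t ht => (hS t ht).2
  rw [Finset.card_range, nsmul_eq_mul] at hNs hSs
  have hT0 : (0 : ℝ) < T := by exact_mod_cast hT
  have hgap : 0 ≤ gap f x₀ := sub_nonneg.2 (ciInf_le hf.bdd_below x₀)
  have heff : 0 ≤ effHessNoiseCube (Module.finrank ℝ E) β σh δh := by
    have := Real.log_natCast_nonneg (Module.finrank ℝ E)
    unfold effHessNoiseCube
    positivity
  rw [hout, div_le_iff₀ hT0]
  refine hle.trans ?_
  have hbound : √M * gap f x₀ + 8 * (∑ t ∈ Finset.range T, ∫ ω, N t ω ∂P + (∫ ω, a ω ∂P) / α)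
      + 292 / M ^ (3 / 2 : ℝ) * (∑ t ∈ Finset.range T, ∫ ω, S t ω ∂P + (∫ ω, b ω ∂P) / β)
      ≤ √M * gap f x₀ + 8 * (T * (α ^ (3 / 4 : ℝ) * σg ^ (3 / 2 : ℝ)) + σg0 ^ (3 / 2 : ℝ) / α)
      + 292 / M ^ (3 / 2 : ℝ) * (T * (2000 * (β ^ (3 / 2 : ℝ)
        * effHessNoiseCube (Module.finrank ℝ E) β σh δh)) + σh0 ^ 3 / β) := by gcongr
  have p1 : 0 ≤ √M * gap f x₀ := by positivity
  have p2 : 0 ≤ T * (α ^ (3 / 4 : ℝ) * σg ^ (3 / 2 : ℝ)) := by positivity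
  have p3 : 0 ≤ σg0 ^ (3 / 2 : ℝ) / α := by positivity
  have p4 : 0 ≤ T * (β ^ (3 / 2 : ℝ) * effHessNoiseCube (Module.finrank ℝ E) β σh δh
    / M ^ (3 / 2 : ℝ)) := by positivity
  have p5 : 0 ≤ σh0 ^ 3 / β / M ^ (3 / 2 : ℝ) := by positivity
  have erate : rate (Module.finrank ℝ E) T (gap f x₀) M α β σg0 σh0 σg σh δh * T
      = √M * gap f x₀ + σh0 ^ 3 / β / M ^ (3 / 2 : ℝ) + σg0 ^ (3 / 2 : ℝ) / α
        + T * (β ^ (3 / 2 : ℝ) * effHessNoiseCube (Module.finrank ℝ E) β σh δh / M ^ (3 / 2 : ℝ))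
        + T * (α ^ (3 / 4 : ℝ) * σg ^ (3 / 2 : ℝ)) := by
    unfold rate
    field_simp
  rw [mul_assoc, erate]
  -- The largest constant, 10000 · 292 · 2000 = 5.84 · 10⁹, is what the factor 10¹⁰ has to cover.
  have e5 : 292 / M ^ (3 / 2 : ℝ) * (T * (2000 * (β ^ (3 / 2 : ℝ)
        * effHessNoiseCube (Module.finrank ℝ E) β σh δh)) + σh0 ^ 3 / β)
      = 584000 * (T * (β ^ (3 / 2 : ℝ) * effHessNoiseCube (Module.finrank ℝ E) β σh δh
        / M ^ (3 / 2 : ℝ))) + 292 * (σh0 ^ 3 / β / M ^ (3 / 2 : ℝ)) := by ring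
  rw [e5] at hbound
  linarith

end Run

/-! ### Choice of parameters for a target accuracy. -/

section Parameters

lemma effHessNoiseCube_nonneg (d : ℕ) {β σh δh : ℝ} (hβ : 0 ≤ β) (hσ : 0 ≤ σh) (hδ : 0 ≤ δh) :
    0 ≤ effHessNoiseCube d β σh δh := by
  have := Real.log_natCast_nonneg d
  unfold effHessNoiseCube
  positivity

/-- For every target accuracy there are momentum and regularization parameters for which the
rate is eventually below the target. -/
lemma exists_parameters_rate_le (d : ℕ) {L Δ σg0 σh0 σg σh δh ε : ℝ} (hL : 0 ≤ L) (hΔ : 0 ≤ Δ)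
    (hσg0 : 0 ≤ σg0) (hσh0 : 0 ≤ σh0) (hσg : 0 ≤ σg) (hσh : 0 ≤ σh) (hδh : 0 ≤ δh) (hε : 0 < ε) :
    ∃ M α β : ℝ, α ∈ Set.Ioc (0 : ℝ) 1 ∧ β ∈ Set.Ioc (0 : ℝ) 1 ∧ 0 < M ∧ L ≤ M ∧
      ParamCondition L M α β ∧ ∃ T₀ : ℕ, 1 ≤ T₀ ∧ ∀ (T : ℕ) (_ : T₀ ≤ T) (F₀ : ℝ) (_ : F₀ ≤ Δ),
        rate d T F₀ M α β σg0 σh0 σg σh δh ≤ ε := by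
  have hN := effHessNoiseCube_nonneg d zero_le_one hσh hδh
  set N := effHessNoiseCube d 1 σh δh
  set s := σg ^ (3 / 2 : ℝ)
  have hs : 0 ≤ s := by positivity
  -- The summand 1 avoids a division by zero when the gradient noise vanishes.
  set η := ε / (4 * (s + 1)) with hη
  have hη0 : 0 < η := by positivity
  set α := min 1 (η ^ (4 / 3 : ℝ)) with hα
  have hα0 : 0 < α := lt_min one_pos (by positivity)
  have hαη : α ^ (3 / 4 : ℝ) ≤ η := by
    calc α ^ (3 / 4 : ℝ) ≤ (η ^ (4 / 3 : ℝ)) ^ (3 / 4 : ℝ) := by gcongr; exact min_le_right _ _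
      _ = η := by rw [← Real.rpow_mul hη0.le]; norm_num
  set A := 4 * √3 * L ^ (3 / 2 : ℝ) / α ^ 3 with hA
  have hA0 : 0 ≤ A := by positivity
  -- With β = 1 and α already fixed, each summand of M serves one requirement: M ≥ 1 (so M ≤
  -- M^{3/2}), M ≥ L, Hessian noise at most ε/4, and the parameter condition, where 657 = 73 · 9.
  set M := 1 + L + 4 * N / ε + 72 * (A + 657 * L ^ 3) with hM
  have q1 : 0 ≤ 4 * N / ε := by positivity
  have q2 : 0 ≤ 657 * L ^ 3 := by positivity
  have hM1 : 1 ≤ M := by linarith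
  have hM0 : 0 < M := by linarith
  have hm : M ≤ M ^ (3 / 2 : ℝ) := Real.self_le_rpow_of_one_le hM1 (by norm_num)
  set m := M ^ (3 / 2 : ℝ)
  have hm1 : 1 ≤ m := hM1.trans hm
  have hm0 : 0 < m := by linarith
  refine ⟨M, α, 1, ⟨hα0, min_le_left _ _⟩, ⟨one_pos, le_rfl⟩, hM0, by linarith, ?_, ?_⟩
  · have : 73 / m * (9 * L ^ 3 / 1 ^ 3) ≤ 657 * L ^ 3 := by
      calc _ = 657 * L ^ 3 / m := by ring
        _ ≤ _ := div_le_self q2 hm1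
    unfold ParamCondition
    linarith
  set X := √M * Δ + σh0 ^ 3 / m + σg0 ^ (3 / 2 : ℝ) / α with hX
  have hX0 : 0 ≤ X := by positivity
  refine ⟨⌈2 * X / ε⌉₊ + 1, by omega, fun T hT F₀ hF₀ => ?_⟩
  have hT0 : (0 : ℝ) < T := by exact_mod_cast (by omega : 0 < T)
  have hXT : X / T ≤ ε / 2 := by
    have h1 : 2 * X / ε ≤ T := (Nat.le_ceil _).trans (by exact_mod_cast (by omega))
    rw [div_le_iff₀ hε] at h1
    rw [div_le_iff₀ hT0]
    linarith
  have h2 : N / m ≤ ε / 4 := by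
    have h3 : 4 * N / ε ≤ m := by linarith
    rw [div_le_iff₀ hε] at h3
    rw [div_le_iff₀ hm0]
    linarith
  have h3 : α ^ (3 / 4 : ℝ) * s ≤ ε / 4 := by
    calc _ ≤ η * (s + 1) := by gcongr; linarith
      _ = ε / 4 := by rw [hη]; field_simp
  calc rate d T F₀ M α 1 σg0 σh0 σg σh δh
      = (√M * F₀ + σh0 ^ 3 / m + σg0 ^ (3 / 2 : ℝ) / α) / T + N / m + α ^ (3 / 4 : ℝ) * s := by
        change √M * F₀ / T + σh0 ^ 3 / (m * 1 * T) + σg0 ^ (3 / 2 : ℝ) / (α * T)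
          + 1 ^ (3 / 2 : ℝ) * N / m + α ^ (3 / 4 : ℝ) * s = _
        rw [Real.one_rpow]
        field_simp
    _ ≤ X / T + N / m + α ^ (3 / 4 : ℝ) * s := by rw [hX]; gcongr
    _ ≤ ε := by linarith

end Parameters

end CubicNewton

theorem mainTheorem1 :
    -- the rate, with a universal constant
    (∃ C : ℝ, 0 < C ∧
      ∀ (d : ℕ) (_ : 1 ≤ d) (T : ℕ) (_ : 1 ≤ T)
        (L M α β σg0 σh0 σg σh δh : ℝ)
        (_ : 0 ≤ σg0) (_ : 0 ≤ σh0) (_ : 0 ≤ σg) (_ : 0 ≤ σh) (_ : 0 ≤ δh)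
        (_ : α ∈ Set.Ioc (0 : ℝ) 1) (_ : β ∈ Set.Ioc (0 : ℝ) 1) (_ : 0 < M) (_ : L ≤ M)
        (_ : CubicNewton.ParamCondition L M α β)
        (Ω : Type u) [MeasurableSpace Ω] (P : Measure Ω) [IsProbabilityMeasure P]
        (Ξ : Type v) [MeasurableSpace Ξ]
        (f : EuclideanSpace ℝ (Fin d) → ℝ) (F : Ξ → EuclideanSpace ℝ (Fin d) → ℝ) (x₀ : EuclideanSpace ℝ (Fin d))
        (ξg ξh : ℕ → Ω → Ξ) (ℱ : Filtration ℕ (inferInstance : MeasurableSpace Ω))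
        (x : ℕ → Ω → EuclideanSpace ℝ (Fin d)) (xout : Ω → EuclideanSpace ℝ (Fin d))
        (_ : CubicNewton.IsObjective f L) (_ : CubicNewton.IsStochasticFamily F)
        (_ : ∀ t, 1 ≤ t → t < T → CubicNewton.GradientNoise P f F (ξg t) σg)
        (_ : ∀ t, 1 ≤ t → t < T → CubicNewton.HessianNoise P f F (ξh t) σh δh)
        (_ : CubicNewton.InitialGradientNoise P f F (ξg 0) x₀ σg0)
        (_ : CubicNewton.InitialHessianNoise P f F (ξh 0) x₀ σh0)
        (_ : CubicNewton.IsRun P ℱ F x₀ M α β T ξg ξh x)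
        (_ : CubicNewton.IsUniformOutput P T x xout),
        Integrable (fun ω => CubicNewton.mu f M (xout ω)) P ∧
        ∫ ω, CubicNewton.mu f M (xout ω) ∂P ≤
          C * CubicNewton.rate d T (CubicNewton.gap f x₀) M α β σg0 σh0 σg σh δh) ∧
    -- convergence for arbitrary noise levels, by a choice of the parameters
    (∀ (d : ℕ) (_ : 1 ≤ d) (L Δ σg0 σh0 σg σh δh ε : ℝ) (_ : 0 ≤ L) (_ : 0 ≤ Δ)
      (_ : 0 ≤ σg0) (_ : 0 ≤ σh0) (_ : 0 ≤ σg) (_ : 0 ≤ σh) (_ : 0 ≤ δh) (_ : 0 < ε),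
      ∃ M α β : ℝ, α ∈ Set.Ioc (0 : ℝ) 1 ∧ β ∈ Set.Ioc (0 : ℝ) 1 ∧ 0 < M ∧ L ≤ M ∧
        CubicNewton.ParamCondition L M α β ∧
        ∃ T₀ : ℕ, 1 ≤ T₀ ∧ ∀ (T : ℕ) (_ : T₀ ≤ T)
          (Ω : Type u) [MeasurableSpace Ω] (P : Measure Ω) [IsProbabilityMeasure P]
          (Ξ : Type v) [MeasurableSpace Ξ]
          (f : EuclideanSpace ℝ (Fin d) → ℝ) (F : Ξ → EuclideanSpace ℝ (Fin d) → ℝ)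
          (x₀ : EuclideanSpace ℝ (Fin d))
          (ξg ξh : ℕ → Ω → Ξ) (ℱ : Filtration ℕ (inferInstance : MeasurableSpace Ω))
          (x : ℕ → Ω → EuclideanSpace ℝ (Fin d)) (xout : Ω → EuclideanSpace ℝ (Fin d))
          (_ : CubicNewton.IsObjective f L) (_ : CubicNewton.gap f x₀ ≤ Δ)
          (_ : CubicNewton.IsStochasticFamily F)
          (_ : ∀ t, 1 ≤ t → t < T → CubicNewton.GradientNoise P f F (ξg t) σg)
          (_ : ∀ t, 1 ≤ t → t < T → CubicNewton.HessianNoise P f F (ξh t) σh δh)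
          (_ : CubicNewton.InitialGradientNoise P f F (ξg 0) x₀ σg0)
          (_ : CubicNewton.InitialHessianNoise P f F (ξh 0) x₀ σh0)
          (_ : CubicNewton.IsRun P ℱ F x₀ M α β T ξg ξh x)
          (_ : CubicNewton.IsUniformOutput P T x xout),
          Integrable (fun ω => CubicNewton.mu f M (xout ω)) P ∧
          ∫ ω, CubicNewton.mu f M (xout ω) ∂P ≤ ε) := by
  have key : ∀ d : ℕ, Module.finrank ℝ (EuclideanSpace ℝ (Fin d)) = d := fun d => finrank_euclideanSpace_fin
  refine ⟨⟨10 ^ 10, by norm_num, ?_⟩, ?_⟩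
  · intro d hd T hT L M α β σg0 σh0 σg σh δh hσg0 hσh0 hσg hσh hδh hα hβ hM hL hpar Ω _ P _ Ξ _
      f F x₀ ξg ξh ℱ x xout hf hF hg hh hg0 hh0 hrun hout
    have := hrun.integral_mu_le (by rwa [key]) hT hσg0 hσg hσh hδh hσh0 hα hβ hM hL hpar hf hF
      hg hh hg0 hh0 hout
    rwa [key] at this
  · intro d hd L Δ σg0 σh0 σg σh δh ε hL hΔ hσg0 hσh0 hσg hσh hδh hε
    obtain ⟨M, α, β, hα, hβ, hM, hLM, hpar, T₀, hT₀, hrate⟩ :=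
      -- The target is divided by the universal constant of the rate.
      CubicNewton.exists_parameters_rate_le d hL hΔ hσg0 hσh0 hσg hσh hδh
        (by positivity : 0 < ε / 10 ^ 10)
    refine ⟨M, α, β, hα, hβ, hM, hLM, hpar, T₀, hT₀, ?_⟩
    intro T hT Ω _ P _ Ξ _ f F x₀ ξg ξh ℱ x xout hf hgap hF hg hh hg0 hh0 hrun hout
    obtain ⟨h1, h2⟩ := hrun.integral_mu_le (by rwa [key]) (hT₀.trans hT) hσg0 hσg hσh hδh hσh0
      hα hβ hM hLM hpar hf hF hg hh hg0 hh0 hout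
    rw [key] at h2
    refine ⟨h1, h2.trans ?_⟩
    have h3 := hrate T hT _ hgap
    rw [le_div_iff₀ (by norm_num)] at h3
    linarith
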